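/- Let $n\in\mathbb{N}$, $1<p<\infty$ and let $q$ be the conjugate exponent, $pq=p+q$. Let $\mathbb{H}^{2n+1}=\{(x,y,z):x,y\in\mathbb{R}^n,\ z\in\mathbb{R}\}$ be the Heisenberg group with multiplication $$(x,y,z)\cdot(x',y',z')=\bigl(x+x',\,y+y',\,z+z'+\tfrac12(\langle x,y'\rangle-\langle x',y\rangle)\bigr),$$ and let $U=\{(\dot x,\dot y)\in\mathbb{R}^n\times\mathbb{R}^n:\sum_{i=1}^n(|\dot x_i|^p+|\dot y_i|^p)\le 1\}$. Consider the left-invariant time-minimization problem $T\to\min$, $\dot g(t)\in g(t)U$, $g(0)=(0,0,0)$, $g(T)=g_1$, where $g\,(\dot x,\dot y)$ is the tangent vector at $g=(x,y,z)$ with coordinates $\bigl(\dot x,\dot y,\tfrac12(\langle x,\dot y\rangle-\langle\dot x,y\rangle)\bigr)$. An extremal on $[0,T]$ is the projection to $\mathbb{H}^{2n+1}$ of a solution of the Pontryagin maximum principle: an absolutely continuous curve $g:[0,T]\to\mathbb{H}^{2n+1}$ with $g(0)=(0,0,0)$, generated by a measurable control $w:[0,T]\to U$ via $\dot g=g\,w$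 a.e., for which there is a nowhere vanishing absolutely continuous covector $P=(\varphi,\psi,\gamma)$ such that, for $H(P,g,w)=\langle P,g\,w\rangle$, one has $\dot P=-\partial H/\partial g$ and $H(P(t),g(t),w(t))=\max_{w'\in U}H(P(t),g(t),w')$ for a.e. $t$. For $r>1$ put $\mathbb{S}_r=4\,\Gamma(1+\frac1r)^2/\Gamma(1+\frac2r)$ and $B(s;a,b)=\int_0^s\tau^{a-1}(1-\tau)^{b-1}\,d\tau$. Let $\phi=\phi_r(\theta)$ be the unique solution of $$\theta=\frac{k-[k/2]}{2}\,\mathbb{S}_r+(-1)^k\,\tfrac1r\,4^{-1/r}\,B\bigl(\sin^2 2\phi;\tfrac1r,\tfrac12\bigr),\qquad k=\Bigl[\frac{4\phi}{\pi}\Bigr],$$ where $[\cdot]$ is the integer part (floor), and define Shelupsky's functions $$\cos_r\theta=|\cos\phi_r(\theta)|^{2/r}\,\mathrm{sgn}\cos\phi_r(\theta),\qquad \sin_r\theta=|\sin\phi_r(\theta)|^{2/r}\,\mathrm{sgn}\sin\phi_r(\theta).$$ Let $T\ge0$. Then for any extremal $(x(t),y(t),z(t))$ on $[0,T]$ there exist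 constants $\gamma\in\{0,1,-1\}$ and $A=(A_1,\dots,A_n)$ with all $A_i\ge0$, not both zero ($\gamma\neq0$ or $A\ne0$), such that for $\alpha=\bigl(\sum_jA_j^q\bigr)^{1/q}$ the following holds on $[0,T]$. 1. If $\gamma\ne0$, then for each $i$ with $A_i>0$ there exists a constant $\theta_{i0}^\circ\in\mathbb{R}$ such that $$x_i=\gamma A_i\bigl(\sin_q\theta_i^\circ-\sin_q\theta_{i0}^\circ\bigr),\qquad y_i=\gamma A_i\bigl(\cos_q\theta_{i0}^\circ-\cos_q\theta_i^\circ\bigr),\qquad \theta_i^\circ=\theta_{i0}^\circ+\gamma A_i^{q-2}\alpha^{-q/p}\,t;$$ for each $i$ with $A_i=0$ one has $x_i\equiv y_i\equiv0$; and $$2z=\gamma\alpha t+\sum_{i:\,A_i>0}A_i^2\bigl(\sin_q\theta_{i0}^\circ\cos_q\theta_i^\circ-\cos_q\theta_{i0}^\circ\sin_q\theta_i^\circ\bigr).$$ 2. If $\gamma=0$, then for each $i$ with $A_i>0$ $$x_i=A_i^{q-1}\alpha^{-q/p}\,u_i\,t,\qquad y_i=A_i^{q-1}\alpha^{-q/p}\,v_i\,t,$$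 where $(u_i,v_i)$ is a fixed point of the boundary of $\Omega=\{(u,v)\in\mathbb{R}^2:|u|^p+|v|^p\le1\}$; for each $i$ with $A_i=0$ one has $x_i\equiv y_i\equiv0$; and $z\equiv0$. Conversely, every curve $(x(t),y(t),z(t))$ on $[0,T]$ of one of the described forms is an extremal. -/

import Mathlib

/-! ## The Heisenberg group -/

/-- The Heisenberg group `ℍ^{2n+1}`, with coordinates `(x, y, z) ∈ ℝⁿ × ℝⁿ × ℝ`. -/
@[ext] structure Heisenberg (n : ℕ) where
  x : Fin n → ℝ
  y : Fin n → ℝ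
  z : ℝ

namespace Heisenberg

variable {n : ℕ}

noncomputable instance : Mul (Heisenberg n) where
  mul a b := ⟨a.x + b.x, a.y + b.y,
    a.z + b.z + (1 / 2) * ((∑ i, a.x i * b.y i) - ∑ i, b.x i * a.y i)⟩

instance : One (Heisenberg n) where
  one := ⟨0, 0, 0⟩

instance : Inv (Heisenberg n) where
  inv a := ⟨-a.x, -a.y, -a.z⟩

@[simp] theorem mul_x (a b : Heisenberg n) : (a * b).x = a.x + b.x := rfl
@[simp] theorem mul_y (a b : Heisenberg n) : (a * b).y = a.y + b.y := rfl
@[simp] theorem mul_z (a b : Heisenberg n) : (a * b).z =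
    a.z + b.z + (1 / 2) * ((∑ i, a.x i * b.y i) - ∑ i, b.x i * a.y i) := rfl
@[simp] theorem one_x : (1 : Heisenberg n).x = 0 := rfl
@[simp] theorem one_y : (1 : Heisenberg n).y = 0 := rfl
@[simp] theorem one_z : (1 : Heisenberg n).z = 0 := rfl
@[simp] theorem inv_x (a : Heisenberg n) : (a⁻¹).x = -a.x := rfl
@[simp] theorem inv_y (a : Heisenberg n) : (a⁻¹).y = -a.y := rfl
@[simp] theorem inv_z (a : Heisenberg n) : (a⁻¹).z = -a.z := rfl

noncomputable instance : Group (Heisenberg n) :=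
  Group.ofLeftAxioms
    (by
      intro a b c
      ext
      · simp [add_assoc]
      · simp [add_assoc]
      · simp only [mul_z, mul_x, mul_y, Pi.add_apply, add_mul, mul_add, Finset.sum_add_distrib]
        ring)
    (by intro a; ext <;> simp)
    (by
      intro a
      ext
      · simp
      · simp
      · simp only [mul_z, inv_x, inv_y, inv_z, one_z, Pi.neg_apply, neg_mul, mul_neg,
          Finset.sum_neg_distrib]
        ring)

/-! ## Left-invariant control systems and the Pontryagin maximum principle -/

/-- Tangent vectors and covectors of `ℍ^{2n+1}`, in the coordinates `(x, y, z)`. -/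
abbrev Coord (n : ℕ) := (Fin n → ℝ) × (Fin n → ℝ) × ℝ

/-- The coordinates of the tangent vector `q · w ∈ Δ(q)`, the image of
`w = (ẋ, ẏ) ∈ Δ(1) = ℝⁿ × ℝⁿ` under the differential of the left translation by `q`
(see `hasDerivAt_mul_left`). -/
noncomputable def leftVelocity (q : Heisenberg n) (w : (Fin n → ℝ) × (Fin n → ℝ)) : Coord n :=
  (w.1, w.2, (1 / 2) * ((∑ i, q.x i * w.2 i) - ∑ i, w.1 i * q.y i))

/-- `leftVelocity q w` is the velocity at `s = 0` of the curve `q · (s ẋ, s ẏ, 0)`. -/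
theorem hasDerivAt_mul_left (q : Heisenberg n) (w : (Fin n → ℝ) × (Fin n → ℝ)) :
    HasDerivAt (fun s : ℝ =>
      (((q * ⟨s • w.1, s • w.2, 0⟩ : Heisenberg n).x,
        (q * ⟨s • w.1, s • w.2, 0⟩ : Heisenberg n).y,
        (q * ⟨s • w.1, s • w.2, 0⟩ : Heisenberg n).z) : Coord n)) (leftVelocity q w) 0 := by
  have h : (fun s : ℝ =>
      (((q * ⟨s • w.1, s • w.2, 0⟩ : Heisenberg n).x,
        (q * ⟨s • w.1, s • w.2, 0⟩ : Heisenberg n).y,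
        (q * ⟨s • w.1, s • w.2, 0⟩ : Heisenberg n).z) : Coord n)) =
      fun s : ℝ => ((q.x, q.y, q.z) : Coord n) + s • leftVelocity q w := by
    funext s
    refine Prod.ext rfl (Prod.ext rfl ?_)
    have e1 : ∑ i, q.x i * (s * w.2 i) = s * ∑ i, q.x i * w.2 i := by
      rw [Finset.mul_sum]; exact Finset.sum_congr rfl fun i _ => by ring
    have e2 : ∑ i, s * w.1 i * q.y i = s * ∑ i, w.1 i * q.y i := by
      rw [Finset.mul_sum]; exact Finset.sum_congr rfl fun i _ => by ring
    simp only [mul_z, leftVelocity, Pi.smul_apply, smul_eq_mul, Prod.snd_add, Prod.smul_snd, e1, e2]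
    ring
  rw [h]
  simpa using ((hasDerivAt_id (0 : ℝ)).smul_const (leftVelocity q w)).const_add
    ((q.x, q.y, q.z) : Coord n)

/-- The Pontryagin function `⟨P, q · w⟩` of the covector `P = (φ, ψ, γ)` at the point `q`. -/
noncomputable def pontryagin (P : Coord n) (q : Heisenberg n)
    (w : (Fin n → ℝ) × (Fin n → ℝ)) : ℝ :=
  (∑ i, P.1 i * (leftVelocity q w).1 i) + (∑ i, P.2.1 i * (leftVelocity q w).2.1 i)
    + P.2.2 * (leftVelocity q w).2.2

/-- `q : [0, T] → ℍ^{2n+1}` is a trajectory of `q̇ ∈ q U`, `q(0) = 1`, for the measurable control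
`w`, in the sense of Carathéodory. Only the values of `q` and `w` on `[0, T]` matter. -/
structure IsTrajectory (U : Set ((Fin n → ℝ) × (Fin n → ℝ))) (T : ℝ) (q : ℝ → Heisenberg n)
    (w : ℝ → (Fin n → ℝ) × (Fin n → ℝ)) : Prop where
  measurable_control : Measurable w
  control_mem : ∀ t ∈ Set.Icc 0 T, w t ∈ U
  initial : q 0 = 1
  ac_x : ∀ i, AbsolutelyContinuousOnInterval (fun t => (q t).x i) 0 T
  ac_y : ∀ i, AbsolutelyContinuousOnInterval (fun t => (q t).y i) 0 T
  ac_z : AbsolutelyContinuousOnInterval (fun t => (q t).z) 0 T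
  deriv_x : ∀ i, ∀ᵐ t, t ∈ Set.Icc 0 T →
    HasDerivAt (fun s => (q s).x i) ((leftVelocity (q t) (w t)).1 i) t
  deriv_y : ∀ i, ∀ᵐ t, t ∈ Set.Icc 0 T →
    HasDerivAt (fun s => (q s).y i) ((leftVelocity (q t) (w t)).2.1 i) t
  deriv_z : ∀ᵐ t, t ∈ Set.Icc 0 T →
    HasDerivAt (fun s => (q s).z) ((leftVelocity (q t) (w t)).2.2) t

/-- The Pontryagin maximum principle for the time-minimization problem `q̇ ∈ q U`, `q(0) = 1`:
`P = (φ, ψ, γ)` is a nowhere vanishing absolutely continuous covector along the trajectory `q`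
with control `w`, it satisfies the adjoint Hamiltonian equations `Ṗ = -∂H/∂q`, and the control
maximizes the Pontryagin function almost everywhere. -/
structure IsPMPSolution (U : Set ((Fin n → ℝ) × (Fin n → ℝ))) (T : ℝ) (q : ℝ → Heisenberg n)
    (w : ℝ → (Fin n → ℝ) × (Fin n → ℝ)) (P : ℝ → Coord n) : Prop where
  trajectory : IsTrajectory U T q w
  nonzero : ∀ t ∈ Set.Icc 0 T, P t ≠ 0
  ac_phi : ∀ i, AbsolutelyContinuousOnInterval (fun t => (P t).1 i) 0 T
  ac_psi : ∀ i, AbsolutelyContinuousOnInterval (fun t => (P t).2.1 i) 0 T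
  ac_gamma : AbsolutelyContinuousOnInterval (fun t => (P t).2.2) 0 T
  deriv_phi : ∀ i, ∀ᵐ t, t ∈ Set.Icc 0 T → HasDerivAt (fun s => (P s).1 i)
    (-deriv (fun ξ => pontryagin (P t) ⟨Function.update (q t).x i ξ, (q t).y, (q t).z⟩ (w t))
      ((q t).x i)) t
  deriv_psi : ∀ i, ∀ᵐ t, t ∈ Set.Icc 0 T → HasDerivAt (fun s => (P s).2.1 i)
    (-deriv (fun η => pontryagin (P t) ⟨(q t).x, Function.update (q t).y i η, (q t).z⟩ (w t))
      ((q t).y i)) t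
  deriv_gamma : ∀ᵐ t, t ∈ Set.Icc 0 T → HasDerivAt (fun s => (P s).2.2)
    (-deriv (fun ζ => pontryagin (P t) ⟨(q t).x, (q t).y, ζ⟩ (w t)) ((q t).z)) t
  maximum : ∀ᵐ t, t ∈ Set.Icc 0 T →
    ∀ w' ∈ U, pontryagin (P t) (q t) w' ≤ pontryagin (P t) (q t) (w t)

/-- Extremals on `[0, T]`: projections to `ℍ^{2n+1}` of the solutions of the Pontryagin maximum
principle. -/
def IsExtremal (U : Set ((Fin n → ℝ) × (Fin n → ℝ))) (T : ℝ) (q : ℝ → Heisenberg n) : Prop :=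
  ∃ w P, IsPMPSolution U T q w P

end Heisenberg

/-! ## `L_p` balls and Shelupsky's functions -/

/-- The set of unit velocities: the unit ball of the `L_p` metric on `ℝⁿ × ℝⁿ`. -/
def lpUnitBall (n : ℕ) (p : ℝ) : Set ((Fin n → ℝ) × (Fin n → ℝ)) :=
  {w | ∑ i, (|w.1 i| ^ p + |w.2 i| ^ p) ≤ 1}

/-- The planar `L_p` unit ball `Ω`. -/
def lpDisc (p : ℝ) : Set (ℝ × ℝ) :=
  {w | |w.1| ^ p + |w.2| ^ p ≤ 1}

/-- Incomplete Euler integral of the first kind `B(x; a, b)`. -/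
noncomputable def incompleteBeta (x a b : ℝ) : ℝ :=
  ∫ t in (0 : ℝ)..x, t ^ (a - 1) * (1 - t) ^ (b - 1)

/-- The area `𝕊` of the planar `L_p` unit ball, in terms of the Gamma function. -/
noncomputable def lpArea (p : ℝ) : ℝ :=
  4 * Real.Gamma (1 + 1 / p) ^ 2 / Real.Gamma (1 + 2 / p)

/-- The generalized angle `θ` (twice the area of the sector) of the boundary point
`(|cos φ|^{2/p} sgn cos φ, |sin φ|^{2/p} sgn sin φ)` of the planar `L_p` unit ball:
`θ = (k - [k/2]) 𝕊 / 2 + (-1)^k (1/p) 4^{-1/p} B(sin² 2φ; 1/p, 1/2)` with `k = [4φ/π]`. -/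
noncomputable def lpAngle (p φ : ℝ) : ℝ :=
  ((⌊4 * φ / Real.pi⌋ : ℝ) - (⌊(⌊4 * φ / Real.pi⌋ : ℝ) / 2⌋ : ℝ)) / 2 * lpArea p
    + (-1 : ℝ) ^ ⌊4 * φ / Real.pi⌋ * (1 / p) * (4 : ℝ) ^ (-(1 / p))
      * incompleteBeta (Real.sin (2 * φ) ^ 2) (1 / p) (1 / 2)

/-- `φ_p(θ)`, the unique solution `φ` of `lpAngle p φ = θ`. -/
noncomputable def lpPhi (p : ℝ) : ℝ → ℝ :=
  Function.invFun (lpAngle p)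

/-- Shelupsky's generalized cosine `cos_p`. -/
noncomputable def cosLp (p θ : ℝ) : ℝ :=
  |Real.cos (lpPhi p θ)| ^ (2 / p) * Real.sign (Real.cos (lpPhi p θ))

/-- Shelupsky's generalized sine `sin_p`. -/
noncomputable def sinLp (p θ : ℝ) : ℝ :=
  |Real.sin (lpPhi p θ)| ^ (2 / p) * Real.sign (Real.sin (lpPhi p θ))

/-! ## The explicit trajectories -/

/-- `α = (∑ A_j^q)^{1/q}`. -/
noncomputable def lqNorm {n : ℕ} (q : ℝ) (A : Fin n → ℝ) : ℝ :=
  (∑ j, A j ^ q) ^ (1 / q)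

/-- `θ_i° = θ_{i0}° + γ A_i^{q-2} α^{-q/p} t`. -/
noncomputable def linearAngle {n : ℕ} (p q γ : ℝ) (A θ₀ : Fin n → ℝ) (i : Fin n) (t : ℝ) : ℝ :=
  θ₀ i + γ * A i ^ (q - 2) * lqNorm q A ^ (-(q / p)) * t

/-- The explicit form of the trajectory on `[0, T]` for `γ ≠ 0`. The value of `θ₀ i` is irrelevant
when `A i = 0`. -/
def IsCurvedForm {n : ℕ} (p q T γ : ℝ) (A : Fin n → ℝ) (g : ℝ → Heisenberg n) : Prop :=
  ∃ θ₀ : Fin n → ℝ, ∀ t ∈ Set.Icc 0 T,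
    (∀ i, 0 < A i →
      (g t).x i = γ * A i * (sinLp q (linearAngle p q γ A θ₀ i t) - sinLp q (θ₀ i)) ∧
      (g t).y i = γ * A i * (cosLp q (θ₀ i) - cosLp q (linearAngle p q γ A θ₀ i t))) ∧
    (∀ i, A i = 0 → (g t).x i = 0 ∧ (g t).y i = 0) ∧
    2 * (g t).z = γ * lqNorm q A * t + ∑ i, A i ^ 2 *
      (sinLp q (θ₀ i) * cosLp q (linearAngle p q γ A θ₀ i t)
        - cosLp q (θ₀ i) * sinLp q (linearAngle p q γ A θ₀ i t))

/-- The explicit form of the trajectory on `[0, T]` for `γ = 0`: a straight line with `z ≡ 0`. -/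
def IsStraightForm {n : ℕ} (p q T : ℝ) (A : Fin n → ℝ) (g : ℝ → Heisenberg n) : Prop :=
  ∃ u v : Fin n → ℝ, (∀ i, 0 < A i → (u i, v i) ∈ frontier (lpDisc p)) ∧
    ∀ t ∈ Set.Icc 0 T,
      (∀ i, 0 < A i →
        (g t).x i = A i ^ (q - 1) * lqNorm q A ^ (-(q / p)) * u i * t ∧
        (g t).y i = A i ^ (q - 1) * lqNorm q A ^ (-(q / p)) * v i * t) ∧
      (∀ i, A i = 0 → (g t).x i = 0 ∧ (g t).y i = 0) ∧
      (g t).z = 0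

/-! Write x* for `dualPow q x`. The Pontryagin function is linear in the control, with coefficients
h_i = φ_i - γ y_i / 2 and k_i = ψ_i + γ x_i / 2. The adjoint equations make γ constant and integrate
to h_i = a_i - γ y_i, k_i = b_i + γ x_i; rescaling the covector gives γ ∈ {0, 1, -1}.

By the equality case of Hölder's inequality (`eq_dual_of_forall_sum_le`), the maximizing control at
a nonzero (h, k) is α^(-q/p) (h*, k*), where α is the L_q norm of (h, k). If γ = 0, the covector and
hence the control are constant, which gives straight lines. If γ = ±1, then h_i' = -γ α^(-q/p) k_i*
and k_i' = γ α^(-q/p) h_i*. Each |h_i|^q + |k_i|^q = A_i^q is conserved (`level_eq_of_isMax`), so α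
is constant and the system splits into planar ones. Since cos_q' = -(sin_q)* and sin_q' = (cos_q)*,
these are solved by A_i (cos_q θ_i, sin_q θ_i) with θ_i affine in t (`covector_eq_of_isMax`). Then x
and y are read off from k and h, and z comes from integration. The converse uses the same formulas
with `dualControl_isMax`.

Two points need analysis. The functions cos_q and sin_q come from a piecewise Beta-function formula,
which `lpAngle_eq_integral` turns into the integral of one periodic density; the derivatives follow
in `hasDerivAt_cosLp` and `hasDerivAt_sinLp`. Moreover x ↦ x* is not Lipschitz at 0 when q < 2, so
uniqueness for the planar system (`IsRotation.eqOn`) has to use the conserved level. -/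

/-! ### Odd powers. -/

/-- The odd power `x ↦ |x| ^ (r - 1) sgn x`, proportional to the derivative of `|x| ^ r`. -/
noncomputable def dualPow (r x : ℝ) : ℝ := |x| ^ (r - 2) * x

@[simp] theorem dualPow_zero (r : ℝ) : dualPow r 0 = 0 := by simp [dualPow]

@[simp] theorem dualPow_neg (r x : ℝ) : dualPow r (-x) = -dualPow r x := by simp [dualPow]

theorem abs_dualPow {r : ℝ} (hr : 1 < r) (x : ℝ) : |dualPow r x| = |x| ^ (r - 1) := by
  rcases eq_or_ne x 0 with rfl | hx
  · rw [dualPow_zero, abs_zero, Real.zero_rpow (by linarith)]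
  · have h := abs_pos.2 hx
    rw [dualPow, abs_mul, abs_of_nonneg (by positivity), ← Real.rpow_add_one h.ne']
    congr 1; ring

theorem mul_dualPow {r : ℝ} (hr : 1 < r) (x : ℝ) : x * dualPow r x = |x| ^ r := by
  rcases eq_or_ne x 0 with rfl | hx
  · rw [dualPow_zero, abs_zero, Real.zero_rpow (by linarith), mul_zero]
  · have h := abs_pos.2 hx
    calc x * dualPow r x = |x| ^ (r - 2) * |x| ^ (2 : ℝ) := by
          rw [dualPow, Real.rpow_two, sq_abs]; ring
      _ = |x| ^ r := by rw [← Real.rpow_add h]; congr 1; ring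

theorem dualPow_mul {r c : ℝ} (hr : 1 < r) (hc : 0 ≤ c) (x : ℝ) :
    dualPow r (c * x) = c ^ (r - 1) * dualPow r x := by
  rcases hc.eq_or_lt with rfl | hc
  · rw [zero_mul, dualPow_zero, Real.zero_rpow (by linarith), zero_mul]
  · rw [dualPow, dualPow, abs_mul, abs_of_pos hc, Real.mul_rpow hc.le (abs_nonneg x),
      show r - 1 = r - 2 + 1 by ring, Real.rpow_add_one hc.ne']
    ring

theorem dualPow_of_nonneg {r x : ℝ} (hr : 1 < r) (hx : 0 ≤ x) : dualPow r x = x ^ (r - 1) := by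
  have h := abs_dualPow hr x
  rwa [abs_of_nonneg (show 0 ≤ dualPow r x from mul_nonneg (by positivity) hx),
    abs_of_nonneg hx] at h

theorem hasDerivAt_abs_rpow_dualPow {r : ℝ} (hr : 1 < r) (x : ℝ) :
    HasDerivAt (fun x : ℝ => |x| ^ r) (r * dualPow r x) x := by
  simpa only [dualPow, mul_assoc] using hasDerivAt_abs_rpow x hr

theorem contDiff_abs_rpow {r : ℝ} (hr : 1 < r) : ContDiff ℝ 1 (fun x : ℝ => |x| ^ r) := by
  simpa only [Real.norm_eq_abs] using contDiff_norm_rpow (E := ℝ) hr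

theorem continuous_dualPow {r : ℝ} (hr : 1 < r) : Continuous (dualPow r) := by
  have h1 : deriv (fun x : ℝ => |x| ^ r) = fun x => r * dualPow r x :=
    funext fun x => (hasDerivAt_abs_rpow_dualPow hr x).deriv
  have h2 := (contDiff_abs_rpow hr).continuous_deriv le_rfl
  rw [h1] at h2
  have h3 : dualPow r = fun x => r⁻¹ * (r * dualPow r x) := by
    funext x; field_simp
  rw [h3]
  exact h2.const_mul _

/-! ### Duality between the L_p ball and the L_q norm. -/

section Conjugate

variable {p q : ℝ}

theorem abs_dualPow_rpow (hpq : p.HolderConjugate q) (x : ℝ) : |dualPow q x| ^ p = |x| ^ q := by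
  rw [abs_dualPow hpq.symm.lt, ← Real.rpow_mul (abs_nonneg x), hpq.symm.sub_one_mul_conj]

/-- Conjugacy means (p - 1)(q - 1) = 1, so the two odd powers are inverse to each other. -/
theorem dualPow_dualPow (hpq : p.HolderConjugate q) (x : ℝ) : dualPow p (dualPow q x) = x := by
  rcases eq_or_ne x 0 with rfl | hx
  · simp
  · have h := abs_pos.2 hx
    rw [dualPow, abs_dualPow hpq.symm.lt, dualPow, ← mul_assoc, ← Real.rpow_mul h.le,
      ← Real.rpow_add h]
    have : (q - 1) * (p - 2) + (q - 2) = 0 := by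
      have := hpq.symm.sub_one_mul_conj
      linarith
    rw [this, Real.rpow_zero, one_mul]

theorem Real.HolderConjugate.div_eq_sub_one (hpq : p.HolderConjugate q) : q / p = q - 1 := by
  have h1 := hpq.ne_zero
  have h2 := hpq.symm.ne_zero
  have h3 := hpq.inv_add_inv_eq_one
  field_simp at h3 ⊢
  linarith

/-- The equality case of Young's inequality. -/
theorem eq_dualPow_of_young_eq (hpq : p.HolderConjugate q) {x w : ℝ}
    (h : |x| ^ q / q + |w| ^ p / p ≤ x * w) : w = dualPow q x := by
  -- Young's inequality bounds this function below by -|x|^q / q, and `h` says that the bound is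
  -- attained at `w`; the vanishing derivative there gives `dualPow p w = x`.
  have hmin : IsLocalMin (fun s : ℝ => |s| ^ p / p - x * s) w := by
    refine Filter.Eventually.of_forall fun s => ?_
    have := Real.young_inequality s x hpq
    simp only
    linarith [mul_comm x s]
  have hd : HasDerivAt (fun s : ℝ => |s| ^ p / p - x * s) (p * dualPow p w / p - x * 1) w :=
    ((hasDerivAt_abs_rpow_dualPow hpq.lt w).div_const p).sub ((hasDerivAt_id w).const_mul x)
  have h0 := hmin.hasDerivAt_eq_zero hd
  have hp := hpq.pos.ne'
  have hx : dualPow p w = x := by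
    rw [mul_div_cancel_left₀ _ hp] at h0
    linarith
  rw [← hx, dualPow_dualPow hpq.symm]

variable {ι : Type*} [Fintype ι]

/-- Hölder's inequality on the unit ball. -/
theorem sum_mul_le_of_sum_rpow_le_one (hpq : p.HolderConjugate q) (h w : ι → ℝ)
    (hw : ∑ j, |w j| ^ p ≤ 1) : ∑ j, h j * w j ≤ (∑ j, |h j| ^ q) ^ (1 / q) := by
  refine (Real.inner_le_Lp_mul_Lq Finset.univ h w hpq.symm).trans ?_
  have : (∑ j, |w j| ^ p) ^ (1 / p) ≤ 1 :=
    Real.rpow_le_one (Finset.sum_nonneg fun _ _ => by positivity) hw hpq.one_div_nonneg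
  exact mul_le_of_le_one_right (by positivity) this

/-- Because |h*|^p = |h|^q, the exponent -(q/p) of the norm is exactly the one that puts the dual
vector on the unit sphere. -/
theorem sum_abs_dual_rpow (hpq : p.HolderConjugate q) (h : ι → ℝ) (hh : 0 < ∑ j, |h j| ^ q) :
    ∑ j, |((∑ j, |h j| ^ q) ^ (1 / q)) ^ (-(q / p)) * dualPow q (h j)| ^ p = 1 := by
  set S := ∑ j, |h j| ^ q
  have h1 : ∀ j, |(S ^ (1 / q)) ^ (-(q / p)) * dualPow q (h j)| ^ p = S⁻¹ * |h j| ^ q := by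
    intro j
    rw [abs_mul, Real.mul_rpow (abs_nonneg _) (abs_nonneg _), abs_dualPow_rpow hpq,
      abs_of_pos (by positivity), ← Real.rpow_mul hh.le, ← Real.rpow_mul hh.le]
    have := hpq.ne_zero
    have := hpq.symm.ne_zero
    rw [show 1 / q * -(q / p) * p = -1 by field_simp, Real.rpow_neg_one]
  simp_rw [h1]
  rw [← Finset.mul_sum, inv_mul_cancel₀ hh.ne']

theorem sum_mul_dual (hpq : p.HolderConjugate q) (h : ι → ℝ) (hh : 0 < ∑ j, |h j| ^ q) :
    ∑ j, h j * (((∑ j, |h j| ^ q) ^ (1 / q)) ^ (-(q / p)) * dualPow q (h j))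
      = (∑ j, |h j| ^ q) ^ (1 / q) := by
  set S := ∑ j, |h j| ^ q with hS
  simp_rw [mul_left_comm (h _), mul_dualPow hpq.symm.lt]
  rw [← Finset.mul_sum, ← hS, ← Real.rpow_mul hh.le]
  nth_rw 2 [← Real.rpow_one S]
  rw [← Real.rpow_add hh]
  congr 1
  have h1 := hpq.ne_zero
  have h2 := hpq.symm.ne_zero
  have h3 := hpq.inv_add_inv_eq_one
  field_simp at h3 ⊢
  linarith

/-- The maximizer of a nonzero linear functional on the `L_p` ball is unique. -/
theorem eq_dual_of_forall_sum_le (hpq : p.HolderConjugate q) (h w : ι → ℝ)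
    (hh : 0 < ∑ j, |h j| ^ q) (hw : ∑ j, |w j| ^ p ≤ 1)
    (hmax : ∀ w' : ι → ℝ, ∑ j, |w' j| ^ p ≤ 1 → ∑ j, h j * w' j ≤ ∑ j, h j * w j) (j : ι) :
    w j = ((∑ j, |h j| ^ q) ^ (1 / q)) ^ (-(q / p)) * dualPow q (h j) := by
  set S := ∑ j, |h j| ^ q with hS
  have hα : 0 < S ^ (1 / q) := by positivity
  set α := S ^ (1 / q) with hαS
  -- The dual vector is an admissible competitor whose pairing with `h` is `α`.
  have h1 : α ≤ ∑ j, h j * w j := by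
    have := hmax _ (sum_abs_dual_rpow hpq h hh).le
    rwa [sum_mul_dual hpq h hh] at this
  have hαq : α ^ q = S := by
    rw [hαS, ← Real.rpow_mul hh.le, one_div_mul_cancel hpq.symm.ne_zero, Real.rpow_one]
  have h2 : ∑ j, |α⁻¹ * h j| ^ q = 1 := by
    simp_rw [abs_mul, abs_of_pos (inv_pos.2 hα), Real.mul_rpow (inv_pos.2 hα).le (abs_nonneg _)]
    rw [← Finset.mul_sum, ← hS, Real.inv_rpow hα.le, hαq, inv_mul_cancel₀ hh.ne']
  -- With `h` scaled to unit norm, the Young bounds sum to at most 1/q + 1/p = 1, while the pairing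
  -- is at least 1. Hence equality holds in every term.
  have hle : ∀ i ∈ Finset.univ,
      α⁻¹ * h i * w i ≤ |α⁻¹ * h i| ^ q / q + |w i| ^ p / p := fun i _ =>
    Real.young_inequality _ _ hpq.symm
  have h3 : 1 ≤ ∑ i, α⁻¹ * h i * w i := by
    simp_rw [mul_assoc]
    rw [← Finset.mul_sum, ← inv_mul_cancel₀ hα.ne']
    exact mul_le_mul_of_nonneg_left h1 (inv_pos.2 hα).le
  have h4 : ∑ i, (|α⁻¹ * h i| ^ q / q + |w i| ^ p / p) ≤ 1 := by
    rw [Finset.sum_add_distrib, ← Finset.sum_div, ← Finset.sum_div, h2]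
    have : (∑ i, |w i| ^ p) / p ≤ 1 / p := div_le_div_of_nonneg_right hw hpq.nonneg
    have h5 := hpq.symm.inv_add_inv_eq_one
    simp only [one_div] at this ⊢
    linarith
  have h6 := (Finset.sum_eq_sum_iff_of_le hle).1
    (le_antisymm (Finset.sum_le_sum hle) (h4.trans h3)) j (Finset.mem_univ j)
  rw [eq_dualPow_of_young_eq hpq h6.ge, dualPow_mul hpq.symm.lt (inv_pos.2 hα).le,
    Real.inv_rpow hα.le, ← Real.rpow_neg hα.le]
  congr 2
  rw [hpq.div_eq_sub_one]

end Conjugate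

/-! ### The generalized angle as the integral of a periodic density. -/

section

open MeasureTheory Real Set intervalIntegral

theorem ofReal_beta_integrand {a b x : ℝ} (hx : x ∈ Icc (0 : ℝ) 1) :
    (x : ℂ) ^ ((a : ℂ) - 1) * (1 - (x : ℂ)) ^ ((b : ℂ) - 1)
      = ((x ^ (a - 1) * (1 - x) ^ (b - 1) : ℝ) : ℂ) := by
  rw [Complex.ofReal_mul, Complex.ofReal_cpow hx.1, Complex.ofReal_cpow (by linarith [hx.2])]
  push_cast
  rfl

theorem intervalIntegrable_beta {a b : ℝ} (ha : 0 < a) (hb : 0 < b) :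
    IntervalIntegrable (fun t : ℝ => t ^ (a - 1) * (1 - t) ^ (b - 1)) volume 0 1 := by
  have h := Complex.betaIntegral_convergent (u := a) (v := b) (by simpa) (by simpa)
  rw [intervalIntegrable_iff_integrableOn_Ioc_of_le zero_le_one] at h ⊢
  refine IntegrableOn.congr_fun (f := fun x : ℝ => RCLike.re
    ((x : ℂ) ^ ((a : ℂ) - 1) * (1 - (x : ℂ)) ^ ((b : ℂ) - 1))) h.re (fun x hx => ?_)
    measurableSet_Ioc
  simp only [ofReal_beta_integrand (Ioc_subset_Icc_self hx), RCLike.re_eq_complex_re,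
    Complex.ofReal_re]

theorem incompleteBeta_one {a b : ℝ} (ha : 0 < a) (hb : 0 < b) :
    incompleteBeta 1 a b = Gamma a * Gamma b / Gamma (a + b) := by
  have h := Complex.betaIntegral_eq_Gamma_mul_div (u := a) (v := b) (by simpa) (by simpa)
  have h2 : Complex.betaIntegral a b = (incompleteBeta 1 a b : ℂ) := by
    rw [Complex.betaIntegral, incompleteBeta, ← intervalIntegral.integral_ofReal]
    refine intervalIntegral.integral_congr fun x hx => ?_
    rw [uIcc_of_le zero_le_one] at hx
    exact ofReal_beta_integrand hx
  rw [h2, ← Complex.ofReal_add, Complex.Gamma_ofReal, Complex.Gamma_ofReal,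
    Complex.Gamma_ofReal] at h
  exact_mod_cast h

/-- The generalized angle of an octant is a quarter of the area. -/
theorem incompleteBeta_one_half_eq_lpArea {r : ℝ} (hr : 0 < r) :
    1 / r * 4 ^ (-(1 / r)) * incompleteBeta 1 (1 / r) (1 / 2) = lpArea r / 4 := by
  have ha : 0 < 1 / r := by positivity
  rw [incompleteBeta_one ha (by norm_num), lpArea, show 2 / r = 2 * (1 / r) by ring]
  set a := 1 / r
  -- Legendre's duplication formula trades Γ(a + 1/2) for Γ(2a); its power of 2 accounts for the
  -- factor 4^(-1/r).
  have h1 := Real.Gamma_mul_Gamma_add_half a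
  have h2 : Gamma (1 + a) = a * Gamma a := by rw [add_comm]; exact Real.Gamma_add_one ha.ne'
  have h3 : Gamma (1 + 2 * a) = 2 * a * Gamma (2 * a) := by
    rw [add_comm]; exact Real.Gamma_add_one (by positivity)
  rw [h2, h3, Real.Gamma_one_half_eq]
  have g1 := Real.Gamma_pos_of_pos ha
  have g2 := Real.Gamma_pos_of_pos (show 0 < 2 * a by positivity)
  have g3 := Real.Gamma_pos_of_pos (show 0 < a + 1 / 2 by positivity)
  have h4 : (2 : ℝ) ^ (1 - 2 * a) = 2 * 4 ^ (-a) := by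
    rw [show (4 : ℝ) = 2 ^ (2 : ℝ) by norm_num, ← Real.rpow_mul two_pos.le, sub_eq_add_neg,
      Real.rpow_add two_pos, Real.rpow_one]
    congr 2; ring
  rw [h4] at h1
  have h5 : √π * 4 ^ (-a) = Gamma a * Gamma (a + 1 / 2) / (2 * Gamma (2 * a)) := by
    rw [h1]; field_simp
  calc a * 4 ^ (-a) * (Gamma a * √π / Gamma (a + 1 / 2))
      = a * Gamma a * (√π * 4 ^ (-a)) / Gamma (a + 1 / 2) := by ring
    _ = _ := by rw [h5]; field_simp

/-- The density of the generalized angle with respect to the parameter `φ`. -/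
noncomputable def lpDensity (r t : ℝ) : ℝ := 2 / r * |sin t * cos t| ^ (2 / r - 1)

theorem lpDensity_neg (r t : ℝ) : lpDensity r (-t) = lpDensity r t := by simp [lpDensity]

theorem lpDensity_periodic (r : ℝ) : Function.Periodic (lpDensity r) (π / 2) := by
  intro t
  simp [lpDensity, sin_add_pi_div_two, cos_add_pi_div_two, mul_comm]

theorem hasDerivAt_incompleteBeta {a b x : ℝ} (ha : 0 < a) (hb : 0 < b) (hx : x ∈ Ioo (0 : ℝ) 1) :
    HasDerivAt (fun x => incompleteBeta x a b) (x ^ (a - 1) * (1 - x) ^ (b - 1)) x := by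
  have hc : ContinuousOn (fun t : ℝ => t ^ (a - 1) * (1 - t) ^ (b - 1)) (Ioo 0 1) := by
    intro t ht
    refine ContinuousAt.continuousWithinAt (ContinuousAt.mul ?_ ?_)
    · exact continuousAt_id.rpow_const (Or.inl ht.1.ne')
    · exact ContinuousAt.rpow_const (by fun_prop) (Or.inl (by linarith [ht.2]))
  refine intervalIntegral.integral_hasDerivAt_right ?_
    (hc.stronglyMeasurableAtFilter isOpen_Ioo x hx) (hc.continuousAt (isOpen_Ioo.mem_nhds hx))
  refine (intervalIntegrable_beta ha hb).mono_set ?_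
  rw [uIcc_of_le hx.1.le, uIcc_of_le zero_le_one]
  exact Icc_subset_Icc_right hx.2.le

theorem continuousOn_incompleteBeta {a b : ℝ} (ha : 0 < a) (hb : 0 < b) :
    ContinuousOn (fun x => incompleteBeta x a b) (Icc 0 1) := by
  have := intervalIntegral.continuousOn_primitive_interval
    ((intervalIntegrable_iff' (by simp)).1 (intervalIntegrable_beta ha hb))
  rwa [uIcc_of_le zero_le_one] at this

/-- The generalized angle on the first octant. -/
noncomputable def octantAngle (r t : ℝ) : ℝ :=
  1 / r * 4 ^ (-(1 / r)) * incompleteBeta (sin (2 * t) ^ 2) (1 / r) (1 / 2)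

/-- At sin² 2t the singular factor (1 - x)^(-1/2) equals 1 / cos 2t and cancels the cos 2t of the
chain rule, while 4^(-1/r) cancels the power of 4 in (4 sin² t cos² t)^(1/r - 1). -/
theorem hasDerivAt_octantAngle {r t : ℝ} (hr : 0 < r) (ht : t ∈ Ioo 0 (π / 4)) :
    HasDerivAt (octantAngle r) (lpDensity r t) t := by
  have ha : 0 < 1 / r := by positivity
  have hπ := pi_pos
  have hS : 0 < sin t := sin_pos_of_pos_of_lt_pi ht.1 (by linarith [ht.2])
  have hC : 0 < cos t := cos_pos_of_mem_Ioo ⟨by linarith [ht.1], by linarith [ht.2]⟩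
  have hC2 : 0 < cos (2 * t) := cos_pos_of_mem_Ioo ⟨by linarith [ht.1], by linarith [ht.2]⟩
  have h1 : 1 - sin (2 * t) ^ 2 = cos (2 * t) ^ 2 := by rw [cos_sq']
  have hm : 0 < sin t * cos t := mul_pos hS hC
  have h2 : sin (2 * t) ^ 2 = 4 * (sin t * cos t) ^ 2 := by rw [sin_two_mul]; ring
  have hx : sin (2 * t) ^ 2 ∈ Ioo (0 : ℝ) 1 := by
    constructor
    · rw [h2]; positivity
    · have := pow_pos hC2 2; linarith
  have hin : HasDerivAt (fun t => sin (2 * t) ^ 2) (8 * (sin t * cos t) * cos (2 * t)) t := by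
    have h0 : HasDerivAt (fun t : ℝ => 2 * t) (2 * 1) t := (hasDerivAt_id t).const_mul 2
    refine (h0.sin.pow 2).congr_deriv ?_
    rw [sin_two_mul]; push_cast; ring
  refine (((hasDerivAt_incompleteBeta ha (b := 1 / 2) (by norm_num) hx).comp t hin).const_mul
    (1 / r * 4 ^ (-(1 / r)))).congr_deriv ?_
  rw [h1, h2, lpDensity, abs_of_pos hm, show 2 / r = 2 * (1 / r) by ring]
  set m := sin t * cos t
  set a := 1 / r
  have e1 : (4 * m ^ 2) ^ (a - 1) = 4 ^ a / 4 * m ^ (2 * a - 1) / m := by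
    rw [Real.mul_rpow (by norm_num) (by positivity), Real.rpow_sub_one (by norm_num),
      ← Real.rpow_two, ← Real.rpow_mul hm.le, mul_div_assoc, ← Real.rpow_sub_one hm.ne']
    congr 2; ring
  have e2 : (cos (2 * t) ^ 2) ^ ((1 : ℝ) / 2 - 1) = (cos (2 * t))⁻¹ := by
    rw [← Real.rpow_two, ← Real.rpow_mul hC2.le, ← Real.rpow_neg_one]
    congr 1; norm_num
  rw [e1, e2, Real.rpow_neg (by norm_num)]
  have : (0 : ℝ) < 4 ^ a := by positivity
  field_simp
  norm_num

theorem continuous_octantAngle {r : ℝ} (hr : 0 < r) : Continuous (octantAngle r) := by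
  refine Continuous.mul continuous_const ?_
  refine (continuousOn_incompleteBeta (a := 1 / r) (b := 1 / 2) (by positivity)
    (by norm_num)).comp_continuous (by fun_prop) fun t => ⟨by positivity, sin_sq_le_one _⟩

theorem octantAngle_zero (r : ℝ) : octantAngle r 0 = 0 := by
  simp [octantAngle, incompleteBeta]

theorem octantAngle_pi_div_four {r : ℝ} (hr : 0 < r) : octantAngle r (π / 4) = lpArea r / 4 := by
  rw [← incompleteBeta_one_half_eq_lpArea hr, octantAngle, show 2 * (π / 4) = π / 2 by ring]
  simp

theorem octantAngle_neg (r t : ℝ) : octantAngle r (-t) = octantAngle r t := by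
  simp [octantAngle]

theorem octantAngle_add_int_mul (r t : ℝ) (m : ℤ) :
    octantAngle r (t + m * (π / 2)) = octantAngle r t := by
  rw [octantAngle, octantAngle, show 2 * (t + m * (π / 2)) = 2 * t + m * π by ring,
    sin_add_int_mul_pi, mul_pow, ← zpow_natCast, ← zpow_mul, mul_comm m, zpow_mul]
  simp

theorem lpDensity_nonneg {r : ℝ} (hr : 0 < r) (t : ℝ) : 0 ≤ lpDensity r t := by
  unfold lpDensity; positivity

/-- For r > 2 the density is unbounded near multiples of π/2. It is nevertheless the nonnegative
derivative of a continuous function on an open octant, hence integrable there; reflection and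
periodicity do the rest. -/
theorem intervalIntegrable_lpDensity {r : ℝ} (hr : 0 < r) (a b : ℝ) :
    IntervalIntegrable (lpDensity r) volume a b := by
  have hπ := pi_pos
  have h4 : (0 : ℝ) ≤ π / 4 := by positivity
  have h1 : IntervalIntegrable (lpDensity r) volume 0 (π / 4) := by
    refine intervalIntegrable_deriv_of_nonneg (continuous_octantAngle hr).continuousOn
      (fun x hx => ?_) fun x _ => lpDensity_nonneg hr x
    rw [min_eq_left h4, max_eq_right h4] at hx
    exact hasDerivAt_octantAngle hr hx
  have h2 : IntervalIntegrable (lpDensity r) volume (-(π / 4)) 0 := by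
    rw [IntervalIntegrable.iff_comp_neg]
    simpa [lpDensity_neg] using h1.symm
  refine (lpDensity_periodic r).intervalIntegrable (by positivity) (t := -(π / 4)) ?_ a b
  rw [show -(π / 4) + π / 2 = π / 4 by ring]
  exact h2.trans h1

theorem integral_lpDensity_octant {r t : ℝ} (hr : 0 < r) (h0 : 0 ≤ t) (ht : t ≤ π / 4) :
    ∫ s in 0..t, lpDensity r s = octantAngle r t := by
  rw [integral_eq_sub_of_hasDerivAt_of_le h0 (continuous_octantAngle hr).continuousOn
    (fun x hx => hasDerivAt_octantAngle hr ⟨hx.1, hx.2.trans_le ht⟩)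
    (intervalIntegrable_lpDensity hr _ _), octantAngle_zero, sub_zero]

theorem integral_lpDensity_octant_neg {r t : ℝ} (hr : 0 < r) (h0 : 0 ≤ t) (ht : t ≤ π / 4) :
    ∫ s in 0..(-t), lpDensity r s = -octantAngle r t := by
  rw [← integral_lpDensity_octant hr h0 ht, integral_symm]
  congr 1
  have := integral_comp_neg (a := 0) (b := t) (lpDensity r)
  simp only [lpDensity_neg, neg_zero] at this
  exact this.symm

/-- A period π/2 consists of two octants, each contributing `lpArea r / 4`. -/
theorem integral_lpDensity_add_int_mul {r : ℝ} (hr : 0 < r) (t : ℝ) (m : ℤ) :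
    ∫ s in 0..(t + m * (π / 2)), lpDensity r s
      = (∫ s in 0..t, lpDensity r s) + m / 2 * lpArea r := by
  have hi := intervalIntegrable_lpDensity hr
  have hπ := pi_pos
  have h4 : (0 : ℝ) ≤ π / 4 := by positivity
  rw [← integral_add_adjacent_intervals (hi 0 t) (hi t _)]
  have h1 := (lpDensity_periodic r).intervalIntegral_add_zsmul_eq m t hi
  rw [zsmul_eq_mul] at h1
  rw [h1, (lpDensity_periodic r).intervalIntegral_add_eq t (-(π / 4)),
    show -(π / 4) + π / 2 = π / 4 by ring,
    ← integral_add_adjacent_intervals (hi (-(π / 4)) 0) (hi 0 _), integral_symm 0,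
    integral_lpDensity_octant_neg hr h4 le_rfl, integral_lpDensity_octant hr h4 le_rfl,
    octantAngle_pi_div_four hr, zsmul_eq_mul]
  ring

/-- An even octant k = 2m is measured forward from m π/2, and an odd one k = 2m + 1 backward from (m
+ 1) π/2. This explains both the sign (-1)^k and the count k - [k/2] of half areas. -/
theorem lpAngle_eq_integral {r : ℝ} (hr : 0 < r) (φ : ℝ) :
    lpAngle r φ = ∫ s in 0..φ, lpDensity r s := by
  have hπ := pi_pos
  have e : lpAngle r φ = ((⌊4 * φ / π⌋ : ℝ) - (⌊(⌊4 * φ / π⌋ : ℝ) / 2⌋ : ℝ)) / 2 * lpArea r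
      + (-1 : ℝ) ^ ⌊4 * φ / π⌋ * octantAngle r φ := by
    simp only [lpAngle, octantAngle]; ring
  have hk1 := Int.floor_le (4 * φ / π)
  have hk2 := Int.lt_floor_add_one (4 * φ / π)
  rw [e]
  generalize ⌊4 * φ / π⌋ = k at hk1 hk2
  rw [le_div_iff₀ hπ] at hk1
  rw [div_lt_iff₀ hπ] at hk2
  obtain ⟨m, rfl | rfl⟩ := Int.even_or_odd' k
  · have hf : ⌊((2 * m : ℤ) : ℝ) / 2⌋ = m := by
      rw [Int.floor_eq_iff]; push_cast; constructor <;> linarith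
    rw [hf, zpow_mul]
    push_cast at hk1 hk2 ⊢
    have h := integral_lpDensity_add_int_mul hr (φ - m * (π / 2)) m
    have h' := octantAngle_add_int_mul r (φ - m * (π / 2)) m
    rw [sub_add_cancel] at h h'
    rw [h, h', integral_lpDensity_octant hr (by linarith) (by linarith)]
    norm_num
    ring
  · have hf : ⌊((2 * m + 1 : ℤ) : ℝ) / 2⌋ = m := by
      rw [Int.floor_eq_iff]; push_cast; constructor <;> linarith
    rw [hf, zpow_add₀ (by norm_num), zpow_mul]
    push_cast at hk1 hk2 ⊢
    have h := integral_lpDensity_add_int_mul hr (φ - ↑(m + 1) * (π / 2)) (m + 1)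
    have h' := octantAngle_add_int_mul r (φ - ↑(m + 1) * (π / 2)) (m + 1)
    rw [sub_add_cancel] at h h'
    rw [h, h', show φ - ↑(m + 1) * (π / 2) = -(↑(m + 1) * (π / 2) - φ) by ring, octantAngle_neg]
    push_cast
    rw [integral_lpDensity_octant_neg hr (by linarith) (by linarith)]
    norm_num
    ring

end

/-! ### Shelupsky's functions and their derivatives. -/

section

open MeasureTheory Real Set intervalIntegral

theorem sin_mul_cos_eq_zero_iff (t : ℝ) : sin t * cos t = 0 ↔ ∃ m : ℤ, t = m * (π / 2) := by
  have : sin t * cos t = 0 ↔ sin (2 * t) = 0 := by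
    rw [sin_two_mul, mul_assoc]; simp
  rw [this, sin_eq_zero_iff]
  constructor
  · rintro ⟨m, hm⟩; exact ⟨m, by linarith⟩
  · rintro ⟨m, hm⟩; exact ⟨m, by linarith⟩

theorem countable_sin_mul_cos_eq_zero : {t : ℝ | sin t * cos t = 0}.Countable := by
  refine (countable_range fun m : ℤ => (m : ℝ) * (π / 2)).mono ?_
  intro t ht
  obtain ⟨m, hm⟩ := (sin_mul_cos_eq_zero_iff t).1 ht
  exact ⟨m, hm.symm⟩

section

variable {r : ℝ}

theorem lpDensity_pos (hr : 0 < r) {t : ℝ} (ht : sin t * cos t ≠ 0) : 0 < lpDensity r t := by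
  have := abs_pos.2 ht
  unfold lpDensity; positivity

theorem continuous_lpAngle (hr : 0 < r) : Continuous (lpAngle r) := by
  rw [funext (lpAngle_eq_integral hr)]
  exact continuous_primitive (intervalIntegrable_lpDensity hr) 0

/-- The density is positive off the countable set of multiples of π/2, so its integral over a
nondegenerate interval is positive. -/
theorem strictMono_lpAngle (hr : 0 < r) : StrictMono (lpAngle r) := by
  intro a b hab
  have hi := intervalIntegrable_lpDensity hr
  rw [lpAngle_eq_integral hr, lpAngle_eq_integral hr, ← integral_add_adjacent_intervals (hi 0 a)
    (hi a b), lt_add_iff_pos_right, integral_pos_iff_support_of_nonneg_ae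
    (.of_forall (lpDensity_nonneg hr)) (hi a b)]
  refine ⟨hab, ?_⟩
  have h1 : Ioc a b \ {t : ℝ | sin t * cos t = 0} ⊆ Function.support (lpDensity r) ∩ Ioc a b :=
    fun t ht => ⟨(lpDensity_pos hr ht.2).ne', ht.1⟩
  refine lt_of_lt_of_le ?_ (measure_mono h1)
  rw [measure_sdiff_null (countable_sin_mul_cos_eq_zero.measure_zero _), Real.volume_Ioc]
  simpa using hab

theorem lpArea_pos (hr : 0 < r) : 0 < lpArea r := by
  have g1 := Real.Gamma_pos_of_pos (show 0 < 1 + 1 / r by positivity)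
  have g2 := Real.Gamma_pos_of_pos (show 0 < 1 + 2 / r by positivity)
  unfold lpArea; positivity

theorem lpAngle_int_mul (hr : 0 < r) (m : ℤ) : lpAngle r (m * (π / 2)) = m / 2 * lpArea r := by
  have := integral_lpDensity_add_int_mul hr 0 m
  rwa [zero_add, ← lpAngle_eq_integral hr, integral_same, zero_add] at this

theorem surjective_lpAngle (hr : 0 < r) : Function.Surjective (lpAngle r) := by
  intro y
  have hS := lpArea_pos hr
  refine mem_range_of_exists_le_of_exists_ge (continuous_lpAngle hr)
    ⟨⌊y / (lpArea r / 2)⌋ * (π / 2), ?_⟩ ⟨⌈y / (lpArea r / 2)⌉ * (π / 2), ?_⟩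
  · rw [lpAngle_int_mul hr]
    have := Int.floor_le (y / (lpArea r / 2))
    rw [le_div_iff₀ (by positivity)] at this
    linarith
  · rw [lpAngle_int_mul hr]
    have := Int.le_ceil (y / (lpArea r / 2))
    rw [div_le_iff₀ (by positivity)] at this
    linarith

theorem lpPhi_lpAngle (hr : 0 < r) (φ : ℝ) : lpPhi r (lpAngle r φ) = φ :=
  Function.leftInverse_invFun (strictMono_lpAngle hr).injective φ

theorem lpAngle_lpPhi (hr : 0 < r) (θ : ℝ) : lpAngle r (lpPhi r θ) = θ :=
  Function.rightInverse_invFun (surjective_lpAngle hr) θ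

theorem continuous_lpPhi (hr : 0 < r) : Continuous (lpPhi r) := by
  let e := (strictMono_lpAngle hr).orderIsoOfSurjective _ (surjective_lpAngle hr)
  have : lpPhi r = e.symm := by
    funext θ
    apply e.injective
    rw [e.apply_symm_apply]
    exact lpAngle_lpPhi hr θ
  rw [this]
  exact e.symm.continuous

theorem hasDerivAt_lpAngle (hr : 0 < r) {t : ℝ} (ht : sin t * cos t ≠ 0) :
    HasDerivAt (lpAngle r) (lpDensity r t) t := by
  rw [funext (lpAngle_eq_integral hr)]
  have hc : ContinuousOn (lpDensity r) {t | sin t * cos t ≠ 0} := by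
    intro s hs
    refine ContinuousAt.continuousWithinAt (ContinuousAt.mul continuousAt_const ?_)
    exact ContinuousAt.rpow_const (by fun_prop) (Or.inl (abs_pos.2 hs).ne')
  have ho : IsOpen {t : ℝ | sin t * cos t ≠ 0} := isOpen_ne_fun (by fun_prop) continuous_const
  exact integral_hasDerivAt_right (intervalIntegrable_lpDensity hr _ _)
    (hc.stronglyMeasurableAtFilter ho t ht) (hc.continuousAt (ho.mem_nhds ht))

theorem hasDerivAt_lpPhi (hr : 0 < r) {θ : ℝ} (h : sin (lpPhi r θ) * cos (lpPhi r θ) ≠ 0) :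
    HasDerivAt (lpPhi r) (lpDensity r (lpPhi r θ))⁻¹ θ :=
  (hasDerivAt_lpAngle hr h).of_local_left_inverse (continuous_lpPhi hr).continuousAt
    (lpDensity_pos hr h).ne' (.of_forall (lpAngle_lpPhi hr))

/-- The odd power `|x| ^ s sgn x`. -/
theorem abs_rpow_mul_sign {s : ℝ} (hs : 0 < s) (x : ℝ) :
    |x| ^ s * Real.sign x = dualPow (s + 1) x := by
  rcases lt_trichotomy x 0 with hx | rfl | hx
  · rw [Real.sign_of_neg hx, ← neg_neg x, dualPow_neg, dualPow_of_nonneg (by linarith)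
      (by linarith), abs_neg, abs_of_pos (neg_pos.2 hx)]
    simp
  · simp
  · rw [Real.sign_of_pos hx, dualPow_of_nonneg (by linarith) hx.le, abs_of_pos hx]
    simp

theorem cosLp_eq (hr : 0 < r) (θ : ℝ) : cosLp r θ = dualPow (2 / r + 1) (cos (lpPhi r θ)) :=
  abs_rpow_mul_sign (by positivity) _

theorem sinLp_eq (hr : 0 < r) (θ : ℝ) : sinLp r θ = dualPow (2 / r + 1) (sin (lpPhi r θ)) :=
  abs_rpow_mul_sign (by positivity) _

theorem continuous_cosLp (hr : 0 < r) : Continuous (cosLp r) := by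
  rw [funext (cosLp_eq hr)]
  exact (continuous_dualPow (lt_add_of_pos_left 1 (by positivity))).comp
    (continuous_cos.comp (continuous_lpPhi hr))

theorem continuous_sinLp (hr : 0 < r) : Continuous (sinLp r) := by
  rw [funext (sinLp_eq hr)]
  exact (continuous_dualPow (lt_add_of_pos_left 1 (by positivity))).comp
    (continuous_sin.comp (continuous_lpPhi hr))

theorem abs_cosLp_rpow (hr : 0 < r) (θ : ℝ) : |cosLp r θ| ^ r = cos (lpPhi r θ) ^ 2 := by
  rw [cosLp_eq hr, abs_dualPow (lt_add_of_pos_left 1 (by positivity)), add_sub_cancel_right,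
    ← Real.rpow_mul (abs_nonneg _), div_mul_cancel₀ _ hr.ne', Real.rpow_two, sq_abs]

theorem abs_sinLp_rpow (hr : 0 < r) (θ : ℝ) : |sinLp r θ| ^ r = sin (lpPhi r θ) ^ 2 := by
  rw [sinLp_eq hr, abs_dualPow (lt_add_of_pos_left 1 (by positivity)), add_sub_cancel_right,
    ← Real.rpow_mul (abs_nonneg _), div_mul_cancel₀ _ hr.ne', Real.rpow_two, sq_abs]

theorem abs_cosLp_rpow_add_abs_sinLp_rpow (hr : 0 < r) (θ : ℝ) :
    |cosLp r θ| ^ r + |sinLp r θ| ^ r = 1 := by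
  rw [abs_cosLp_rpow hr, abs_sinLp_rpow hr, cos_sq_add_sin_sq]

theorem dualPow_comp {a b : ℝ} (hb : 1 < b) (x : ℝ) :
    dualPow a (dualPow b x) = dualPow ((a - 1) * (b - 1) + 1) x := by
  rcases eq_or_ne x 0 with rfl | hx
  · simp
  · have h := abs_pos.2 hx
    rw [dualPow, abs_dualPow hb, dualPow, dualPow, ← mul_assoc, ← Real.rpow_mul h.le,
      ← Real.rpow_add h]
    congr 2; ring

theorem dualPow_two (x : ℝ) : dualPow 2 x = x := by simp [dualPow]

/-- The odd power of exponent r/2, applied to both coordinates, carries the L_r circle to the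
Euclidean circle, where the complex argument supplies φ. -/
theorem exists_lpAngle (hr : 0 < r) {h k : ℝ} (hk : |h| ^ r + |k| ^ r = 1) :
    ∃ θ, cosLp r θ = h ∧ sinLp r θ = k := by
  have h1 : 1 < r / 2 + 1 := lt_add_of_pos_left 1 (by positivity)
  have h2 : 1 < 2 / r + 1 := lt_add_of_pos_left 1 (by positivity)
  have hc : dualPow (r / 2 + 1) h ^ 2 + dualPow (r / 2 + 1) k ^ 2 = 1 := by
    rw [← sq_abs, ← sq_abs (dualPow _ k), abs_dualPow h1, abs_dualPow h1, ← Real.rpow_two,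
      ← Real.rpow_two, ← Real.rpow_mul (abs_nonneg _), ← Real.rpow_mul (abs_nonneg _)]
    simpa using hk
  obtain ⟨φ, h3, h4⟩ : ∃ φ, cos φ = dualPow (r / 2 + 1) h ∧ sin φ = dualPow (r / 2 + 1) k := by
    set z : ℂ := ⟨dualPow (r / 2 + 1) h, dualPow (r / 2 + 1) k⟩
    have hz : ‖z‖ = 1 := by
      rw [← sq_eq_sq₀ (norm_nonneg _) zero_le_one, ← Complex.normSq_eq_norm_sq,
        Complex.normSq_apply, one_pow, ← hc, sq, sq]
    have hz0 : z ≠ 0 := by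
      intro h0; simp [h0] at hz
    exact ⟨z.arg, by rw [Complex.cos_arg hz0, hz, div_one], by rw [Complex.sin_arg, hz, div_one]⟩
  refine ⟨lpAngle r φ, ?_, ?_⟩
  · rw [cosLp_eq hr, lpPhi_lpAngle hr, h3, dualPow_comp h1, add_sub_cancel_right,
      add_sub_cancel_right, div_mul_div_cancel₀ hr.ne']
    norm_num [dualPow_two]
  · rw [sinLp_eq hr, lpPhi_lpAngle hr, h4, dualPow_comp h1, add_sub_cancel_right,
      add_sub_cancel_right, div_mul_div_cancel₀ hr.ne']
    norm_num [dualPow_two]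

theorem hasDerivAt_dualPow {s x : ℝ} (hx : x ≠ 0) :
    HasDerivAt (dualPow s) ((s - 1) * |x| ^ (s - 2)) x := by
  have h := abs_pos.2 hx
  have h1 : HasDerivAt (fun y => |y| ^ (s - 2) * y) _ x :=
    ((hasDerivAt_abs hx).rpow_const (p := s - 2) (Or.inl h.ne')).mul (hasDerivAt_id' x)
  refine h1.congr_deriv ?_
  have h2 : (SignType.sign x : ℝ) * x = |x| := sign_mul_self x
  rw [mul_one, Real.rpow_sub_one h.ne']
  calc _ = ((SignType.sign x : ℝ) * x) / |x| * (s - 2) * |x| ^ (s - 2) + |x| ^ (s - 2) := by ring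
    _ = _ := by rw [h2, div_self h.ne']; ring

/-- The fundamental theorem of calculus tolerates countably many exceptional points, so `f` is a
primitive of the continuous `g`, and then the exceptions disappear. -/
theorem hasDerivAt_of_off_countable {f g : ℝ → ℝ} {s : Set ℝ} (hs : s.Countable)
    (hf : Continuous f) (hg : Continuous g) (h : ∀ x ∉ s, HasDerivAt f (g x) x) (x : ℝ) :
    HasDerivAt f (g x) x := by
  have h1 : f = fun x => f 0 + ∫ t in 0..x, g t := by
    funext x
    rw [integral_eq_of_hasDerivAt_off_countable f g hs hf.continuousOn (fun x hx => h x hx.2)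
      (hg.intervalIntegrable _ _)]
    ring
  rw [h1]
  exact (integral_hasDerivAt_right (hg.intervalIntegrable _ _)
    (hg.stronglyMeasurableAtFilter _ _) hg.continuousAt).const_add _

theorem countable_lpPhi_zero (hr : 0 < r) :
    {θ : ℝ | sin (lpPhi r θ) * cos (lpPhi r θ) = 0}.Countable := by
  refine (countable_sin_mul_cos_eq_zero.image (lpAngle r)).mono fun θ hθ => ?_
  exact ⟨lpPhi r θ, hθ, lpAngle_lpPhi hr θ⟩

/-- This is the chain-rule quotient for cos_r and sin_r, with {x, y} = {cos φ, sin φ}: the powers of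
x cancel against the density, and only a power of y survives. -/
theorem dualPow_derivative_ratio {x y : ℝ} (hr : 0 < r) (hx : x ≠ 0) (hy : y ≠ 0) :
    (2 / r * |x| ^ (2 / r - 1)) * y * (2 / r * |x * y| ^ (2 / r - 1))⁻¹
      = dualPow r (dualPow (2 / r + 1) y) := by
  rw [dualPow_comp (lt_add_of_pos_left 1 (by positivity)), add_sub_cancel_right, dualPow,
    show (r - 1) * (2 / r) + 1 - 2 = -(2 / r - 1) by field_simp; ring, abs_mul,
    Real.mul_rpow (abs_nonneg _) (abs_nonneg _), Real.rpow_neg (abs_nonneg _)]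
  have := abs_pos.2 hx
  have := abs_pos.2 hy
  field_simp

/-- The inverse-function computation is available only away from φ ∈ (π/2)ℤ, where the density may
vanish or blow up. The resulting formula is continuous, so it extends across these countably many
angles. -/
theorem hasDerivAt_cosLp (hr : 1 < r) (θ : ℝ) :
    HasDerivAt (cosLp r) (-dualPow r (sinLp r θ)) θ := by
  have h0 : 0 < r := by linarith
  refine hasDerivAt_of_off_countable (countable_lpPhi_zero h0) (continuous_cosLp h0)
    (g := fun θ => -dualPow r (sinLp r θ))
    ((continuous_dualPow hr).comp (continuous_sinLp h0)).neg (fun θ hθ => ?_) θ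
  have hs := left_ne_zero_of_mul hθ
  have hc := right_ne_zero_of_mul hθ
  rw [funext (cosLp_eq h0)]
  refine ((hasDerivAt_dualPow (s := 2 / r + 1) hc).comp θ
    ((hasDerivAt_cos _).comp θ (hasDerivAt_lpPhi h0 hθ))).congr_deriv ?_
  rw [sinLp_eq h0, ← dualPow_derivative_ratio h0 hc hs, lpDensity,
    mul_comm (cos _) (sin _), show 2 / r + 1 - 1 = 2 / r by ring,
    show 2 / r + 1 - 2 = 2 / r - 1 by ring]
  ring

theorem hasDerivAt_sinLp (hr : 1 < r) (θ : ℝ) :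
    HasDerivAt (sinLp r) (dualPow r (cosLp r θ)) θ := by
  have h0 : 0 < r := by linarith
  refine hasDerivAt_of_off_countable (countable_lpPhi_zero h0) (continuous_sinLp h0)
    (g := fun θ => dualPow r (cosLp r θ))
    ((continuous_dualPow hr).comp (continuous_cosLp h0)) (fun θ hθ => ?_) θ
  have hs := left_ne_zero_of_mul hθ
  have hc := right_ne_zero_of_mul hθ
  rw [funext (sinLp_eq h0)]
  refine ((hasDerivAt_dualPow (s := 2 / r + 1) hs).comp θ
    ((hasDerivAt_sin _).comp θ (hasDerivAt_lpPhi h0 hθ))).congr_deriv ?_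
  rw [cosLp_eq h0, ← dualPow_derivative_ratio h0 hs hc, lpDensity,
    show 2 / r + 1 - 1 = 2 / r by ring, show 2 / r + 1 - 2 = 2 / r - 1 by ring]
  ring

end

end

/-! ### Uniqueness for the planar Hamiltonian system. -/

section

open Set Filter Topology

/-- A solution on `[a, b]` of the planar Hamiltonian system `h' = -c k*`, `k' = c h*` with
`|h| ^ r + |k| ^ r = 1`, where `x* = dualPow r x`. -/
structure IsRotation (r c : ℝ) (a b : ℝ) (h k : ℝ → ℝ) : Prop where
  cont_fst : ContinuousOn h (Icc a b)
  cont_snd : ContinuousOn k (Icc a b)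
  deriv_fst : ∀ t ∈ Ico a b, HasDerivWithinAt h (-(c * dualPow r (k t))) (Ici t) t
  deriv_snd : ∀ t ∈ Ico a b, HasDerivWithinAt k (c * dualPow r (h t)) (Ici t) t
  level : ∀ t ∈ Icc a b, |h t| ^ r + |k t| ^ r = 1

namespace IsRotation

variable {r c a b : ℝ} {h k h' k' : ℝ → ℝ}

theorem neg (H : IsRotation r c a b h k) :
    IsRotation r c a b (fun t => -h t) (fun t => -k t) where
  cont_fst := H.cont_fst.neg
  cont_snd := H.cont_snd.neg
  deriv_fst t ht := by simpa using (H.deriv_fst t ht).fun_neg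
  deriv_snd t ht := by simpa using (H.deriv_snd t ht).fun_neg
  level t ht := by simpa using H.level t ht

/-- The quarter-turn symmetry lets the case h ≠ 0 cover the case k ≠ 0. -/
theorem rotate (H : IsRotation r c a b h k) : IsRotation r c a b k (fun t => -h t) where
  cont_fst := H.cont_snd
  cont_snd := H.cont_fst.neg
  deriv_fst t ht := by simpa using H.deriv_snd t ht
  deriv_snd t ht := by simpa using (H.deriv_fst t ht).fun_neg
  level t ht := by simpa [add_comm] using H.level t ht

theorem mono (H : IsRotation r c a b h k) {a' b' : ℝ} (ha : a ≤ a') (hb : b' ≤ b) :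
    IsRotation r c a' b' h k where
  cont_fst := H.cont_fst.mono (Icc_subset_Icc ha hb)
  cont_snd := H.cont_snd.mono (Icc_subset_Icc ha hb)
  deriv_fst t ht := H.deriv_fst t (Ico_subset_Ico ha hb ht)
  deriv_snd t ht := H.deriv_snd t (Ico_subset_Ico ha hb ht)
  level t ht := H.level t (Icc_subset_Icc ha hb ht)

theorem eq_of_pos (hr : 1 < r) {x y : ℝ} (hx : 0 < x) (h1 : |x| ^ r + |y| ^ r = 1) :
    x = (1 - |y| ^ r) ^ (1 / r) := by
  rw [← eq_sub_iff_add_eq] at h1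
  rw [← h1, abs_of_pos hx, ← Real.rpow_mul hx.le, mul_one_div_cancel (by linarith),
    Real.rpow_one]

theorem dualPow_eq_of_pos (hr : 1 < r) {x y : ℝ} (hx : 0 < x) (h1 : |x| ^ r + |y| ^ r = 1) :
    dualPow r x = (1 - |y| ^ r) ^ ((r - 1) / r) := by
  rw [← eq_sub_iff_add_eq] at h1
  rw [dualPow_of_nonneg hr hx.le, ← h1, abs_of_pos hx, ← Real.rpow_mul hx.le,
    mul_div_cancel₀ _ (by linarith)]

/-- For r < 2 the planar vector field is not Lipschitz on the axes. While h > 0, the level relation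
expresses h through k and leaves a scalar equation for k. Its right-hand side is C¹ near k(a)
because |k(a)|^r < 1, so the classical uniqueness theorem applies. -/
theorem exists_eqOn_of_pos (hr : 1 < r) (hab : a < b) (H : IsRotation r c a b h k)
    (H' : IsRotation r c a b h' k') (h0 : h a = h' a) (k0 : k a = k' a) (hpos : 0 < h a) :
    ∃ d ∈ Ioc a b, EqOn h h' (Icc a d) ∧ EqOn k k' (Icc a d) := by
  have ha : a ∈ Icc a b := left_mem_Icc.2 hab.le
  set v : ℝ → ℝ := fun y => c * (1 - |y| ^ r) ^ ((r - 1) / r) with hv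
  have hsmooth : ContDiffAt ℝ 1 v (k a) := by
    refine contDiffAt_const.mul (ContDiffAt.rpow_const_of_ne
      (contDiffAt_const.sub (contDiff_abs_rpow hr).contDiffAt) ?_)
    have := H.level a ha
    have := Real.rpow_pos_of_pos (abs_pos.2 hpos.ne') r
    linarith
  obtain ⟨K, s, hs, hlip⟩ := hsmooth.exists_lipschitzOnWith
  have ev : ∀ᶠ t in 𝓝[Icc a b] a, (0 < h t ∧ k t ∈ s) ∧ 0 < h' t ∧ k' t ∈ s := by
    refine ((H.cont_fst a ha).eventually (lt_mem_nhds hpos)).and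
      ((H.cont_snd a ha).eventually hs) |>.and ?_
    exact ((H'.cont_fst a ha).eventually (lt_mem_nhds (h0 ▸ hpos))).and
      ((H'.cont_snd a ha).eventually (k0 ▸ hs))
  rw [nhdsWithin_Icc_eq_nhdsGE hab] at ev
  obtain ⟨d, hd, hsub⟩ : ∃ d ∈ Ioc a b, Icc a d ⊆
      {t | (0 < h t ∧ k t ∈ s) ∧ 0 < h' t ∧ k' t ∈ s} := by
    obtain ⟨u, hu, hsub⟩ := mem_nhdsGE_iff_exists_Icc_subset.1 ev
    exact ⟨min u b, ⟨lt_min hu hab, min_le_right _ _⟩,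
      (Icc_subset_Icc_right (min_le_left _ _)).trans hsub⟩
  have hIcc : Icc a d ⊆ Icc a b := Icc_subset_Icc_right hd.2
  have hIco : ∀ t ∈ Ico a d, t ∈ Ico a b := fun t ht => ⟨ht.1, ht.2.trans_le hd.2⟩
  have hk : EqOn k k' (Icc a d) := by
    refine ODE_solution_unique_of_mem_Icc_right (v := fun _ => v) (s := fun _ => s) (K := K)
      (fun _ _ => hlip) (H.cont_snd.mono hIcc) (fun t ht => ?_)
      (fun t ht => (hsub (Ico_subset_Icc_self ht)).1.2) (H'.cont_snd.mono hIcc) (fun t ht => ?_)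
      (fun t ht => (hsub (Ico_subset_Icc_self ht)).2.2) k0
    · have hm := Ico_subset_Icc_self ht
      simp only [hv]
      rw [← dualPow_eq_of_pos hr (hsub hm).1.1 (H.level t (hIcc hm))]
      exact H.deriv_snd t (hIco t ht)
    · have hm := Ico_subset_Icc_self ht
      simp only [hv]
      rw [← dualPow_eq_of_pos hr (hsub hm).2.1 (H'.level t (hIcc hm))]
      exact H'.deriv_snd t (hIco t ht)
  refine ⟨d, hd, fun t ht => ?_, hk⟩
  rw [eq_of_pos hr (hsub ht).1.1 (H.level t (hIcc ht)),
    eq_of_pos hr (hsub ht).2.1 (H'.level t (hIcc ht)), hk ht]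

theorem exists_eqOn_of_ne (hr : 1 < r) (hab : a < b) (H : IsRotation r c a b h k)
    (H' : IsRotation r c a b h' k') (h0 : h a = h' a) (k0 : k a = k' a) (hne : h a ≠ 0) :
    ∃ d ∈ Ioc a b, EqOn h h' (Icc a d) ∧ EqOn k k' (Icc a d) := by
  rcases hne.lt_or_gt with hneg | hpos
  · obtain ⟨d, hd, h1, h2⟩ := exists_eqOn_of_pos hr hab H.neg H'.neg (by simpa) (by simpa)
      (by simpa)
    exact ⟨d, hd, fun t ht => neg_injective (h1 ht), fun t ht => neg_injective (h2 ht)⟩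
  · exact exists_eqOn_of_pos hr hab H H' h0 k0 hpos

theorem exists_eqOn (hr : 1 < r) (hab : a < b) (H : IsRotation r c a b h k)
    (H' : IsRotation r c a b h' k') (h0 : h a = h' a) (k0 : k a = k' a) :
    ∃ d ∈ Ioc a b, EqOn h h' (Icc a d) ∧ EqOn k k' (Icc a d) := by
  by_cases hne : h a = 0
  · have hk : k a ≠ 0 := by
      intro hk
      have := H.level a (left_mem_Icc.2 hab.le)
      rw [hne, hk, abs_zero, Real.zero_rpow (by linarith)] at this
      norm_num at this
    obtain ⟨d, hd, h1, h2⟩ := exists_eqOn_of_ne hr hab H.rotate H'.rotate k0 (by simpa) hk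
    exact ⟨d, hd, fun t ht => neg_injective (h2 ht), h1⟩
  · exact exists_eqOn_of_ne hr hab H H' h0 k0 hne

/-- Solutions are determined by their initial values. -/
theorem eqOn (hr : 1 < r) (H : IsRotation r c a b h k)
    (H' : IsRotation r c a b h' k') (h0 : h a = h' a) (k0 : k a = k' a) :
    EqOn h h' (Icc a b) ∧ EqOn k k' (Icc a b) := by
  -- Continuous induction: the agreement set is closed, and local uniqueness to the right extends it
  -- past each of its points before `b`.
  have hsub : Icc a b ⊆ {t | h t = h' t ∧ k t = k' t} := by
    have hc : ContinuousOn (fun t => (h t - h' t, k t - k' t)) (Icc a b) :=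
      (H.cont_fst.sub H'.cont_fst).prodMk (H.cont_snd.sub H'.cont_snd)
    have hcl : IsClosed ({t | h t = h' t ∧ k t = k' t} ∩ Icc a b) := by
      have := hc.preimage_isClosed_of_isClosed isClosed_Icc (isClosed_singleton (x := (0, 0)))
      convert this using 1
      ext t
      simp [sub_eq_zero, and_comm]
    refine hcl.Icc_subset_of_forall_exists_gt ⟨h0, k0⟩ fun x hx y hy => ?_
    have hm : x < min b y := lt_min hx.2.2 hy
    obtain ⟨d, hd, h1, h2⟩ := exists_eqOn hr hm (H.mono hx.2.1 (min_le_left _ _))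
      (H'.mono hx.2.1 (min_le_left _ _)) hx.1.1 hx.1.2
    have hdm : d ∈ Icc x d := right_mem_Icc.2 hd.1.le
    exact ⟨d, ⟨h1 hdm, h2 hdm⟩, hd.1, hd.2.trans (min_le_right _ _)⟩
  exact ⟨fun t ht => (hsub ht).1, fun t ht => (hsub ht).2⟩

end IsRotation

theorem isRotation_cosLp_sinLp {r : ℝ} (hr : 1 < r) (c θ a b : ℝ) :
    IsRotation r c a b (fun t => cosLp r (θ + c * t)) (fun t => sinLp r (θ + c * t)) := by
  have h0 : 0 < r := by linarith
  have hl : ∀ t, HasDerivAt (fun t => θ + c * t) c t := fun t => by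
    simpa using ((hasDerivAt_id t).const_mul c).const_add θ
  have h1 : ∀ t, HasDerivAt (fun t => cosLp r (θ + c * t)) _ t := fun t =>
    HasDerivAt.comp (h₂ := cosLp r) t (hasDerivAt_cosLp hr (θ + c * t)) (hl t)
  have h2 : ∀ t, HasDerivAt (fun t => sinLp r (θ + c * t)) _ t := fun t =>
    HasDerivAt.comp (h₂ := sinLp r) t (hasDerivAt_sinLp hr (θ + c * t)) (hl t)
  exact
    { cont_fst := fun t _ => (h1 t).continuousAt.continuousWithinAt
      cont_snd := fun t _ => (h2 t).continuousAt.continuousWithinAt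
      deriv_fst := fun t _ => (h1 t).hasDerivWithinAt.congr_deriv (by ring)
      deriv_snd := fun t _ => (h2 t).hasDerivWithinAt.congr_deriv (by ring)
      level := fun t _ => abs_cosLp_rpow_add_abs_sinLp_rpow h0 _ }

end

section

open MeasureTheory Set

/-! ## Absolutely continuous functions -/

namespace AbsolutelyContinuousOnInterval

variable {X : Type*} [PseudoMetricSpace X] {f g : ℝ → X} {a b : ℝ}

theorem congr_eqOn (hf : AbsolutelyContinuousOnInterval f a b) (h : EqOn f g (uIcc a b)) :
    AbsolutelyContinuousOnInterval g a b := by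
  rw [absolutelyContinuousOnInterval_iff] at hf ⊢
  intro ε hε
  obtain ⟨δ, hδ, H⟩ := hf ε hε
  refine ⟨δ, hδ, fun E hE hs => lt_of_eq_of_lt (Finset.sum_congr rfl fun i hi => ?_) (H E hE hs)⟩
  rw [h (hE.1 i hi).1, h (hE.1 i hi).2]

theorem lipschitzOnWith_comp {Y : Type*} [PseudoMetricSpace Y] {F : X → Y} {K : NNReal} {s : Set X}
    (hF : LipschitzOnWith K F s) (hf : AbsolutelyContinuousOnInterval f a b)
    (hs : MapsTo f (uIcc a b) s) : AbsolutelyContinuousOnInterval (fun t => F (f t)) a b := by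
  rw [absolutelyContinuousOnInterval_iff] at hf ⊢
  intro ε hε
  obtain ⟨δ, hδ, H⟩ := hf (ε / (K + 1)) (by positivity)
  refine ⟨δ, hδ, fun E hE hl => ?_⟩
  have h1 := H E hE hl
  rw [lt_div_iff₀ (by positivity)] at h1
  refine lt_of_le_of_lt ?_ h1
  rw [Finset.sum_mul]
  refine Finset.sum_le_sum fun i hi => ?_
  refine (hF.dist_le_mul _ (hs (hE.1 i hi).1) _ (hs (hE.1 i hi).2)).trans ?_
  rw [mul_comm]
  gcongr
  linarith

/-- The range of `f` lies in a compact interval, on which a C¹ function is Lipschitz. -/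
theorem contDiff_comp {f : ℝ → ℝ} {F : ℝ → ℝ} (hF : ContDiff ℝ 1 F)
    (hf : AbsolutelyContinuousOnInterval f a b) :
    AbsolutelyContinuousOnInterval (fun t => F (f t)) a b := by
  obtain ⟨C, hC⟩ := hf.exists_bound
  obtain ⟨K, hK⟩ := hF.contDiffOn.exists_lipschitzOnWith (s := Icc (-C) C) (by decide)
    (convex_Icc _ _) isCompact_Icc
  exact lipschitzOnWith_comp hK hf fun t ht => abs_le.1 (hC t ht)

theorem of_hasDerivAt {f f' : ℝ → ℝ} (h : ∀ t, HasDerivAt f (f' t) t) (hc : Continuous f') :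
    AbsolutelyContinuousOnInterval f a b := by
  refine ContDiffOn.absolutelyContinuousOnInterval (ContDiff.contDiffOn ?_)
  rw [contDiff_one_iff_deriv]
  exact ⟨fun t => (h t).differentiableAt, by rwa [funext fun t => (h t).deriv]⟩

theorem const (c : X) : AbsolutelyContinuousOnInterval (fun _ => c) a b :=
  (LipschitzWith.const c).lipschitzOnWith.absolutelyContinuousOnInterval

variable {T : ℝ}

/-- Two absolutely continuous functions with the same initial value and the same derivative almost
everywhere agree. -/
theorem eqOn_of_ae_hasDerivAt {f g f' : ℝ → ℝ} (hT : 0 ≤ T)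
    (hf : AbsolutelyContinuousOnInterval f 0 T) (hg : AbsolutelyContinuousOnInterval g 0 T)
    (hf' : ∀ᵐ t, t ∈ Icc 0 T → HasDerivAt f (f' t) t)
    (hg' : ∀ᵐ t, t ∈ Icc 0 T → HasDerivAt g (f' t) t) (h0 : f 0 = g 0) : EqOn f g (Icc 0 T) := by
  obtain ⟨C, hC⟩ := (hf.sub hg).const_of_ae_hasDerivAt_zero (by
    rw [uIcc_of_le hT]
    filter_upwards [hf', hg'] with t h1 h2 ht
    simpa using (h1 ht).sub (h2 ht))
  rw [uIcc_of_le hT] at hC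
  intro t ht
  have h1 := hC t ht
  have h2 := hC 0 (left_mem_Icc.2 hT)
  simp only [Pi.sub_apply] at h1 h2
  linarith

/-- An almost-everywhere derivative that agrees with a continuous function makes `f` a C¹ primitive.
This upgrades the Carathéodory equation to the pointwise right derivatives required by ODE
uniqueness. -/
theorem hasDerivWithinAt_of_ae {f g : ℝ → ℝ} (hT : 0 ≤ T)
    (hf : AbsolutelyContinuousOnInterval f 0 T) (hg : ContinuousOn g (Icc 0 T))
    (h : ∀ᵐ t, t ∈ Icc 0 T → HasDerivAt f (g t) t) {t : ℝ} (ht : t ∈ Ico 0 T) :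
    HasDerivWithinAt f (g t) (Ici t) t := by
  set G : ℝ → ℝ := IccExtend hT ((Icc 0 T).domRestrict g) with hGdef
  have hG : Continuous G := (continuousOn_iff_continuous_domRestrict.1 hg).Icc_extend'
  have hGg : ∀ s ∈ Icc 0 T, G s = g s := fun s hs => IccExtend_of_mem hT _ hs
  have hd : ∀ s, HasDerivAt (fun s => f 0 + ∫ u in 0..s, G u) (G s) s := fun s =>
    (intervalIntegral.integral_hasDerivAt_right (hG.intervalIntegrable _ _)
      (hG.stronglyMeasurableAtFilter _ _) hG.continuousAt).const_add _
  -- `G` extends `g` by its endpoint values, so its primitive is differentiable on the whole line.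
  have heq := eqOn_of_ae_hasDerivAt hT hf (of_hasDerivAt hd hG) h
    (.of_forall fun s hs => (hd s).congr_deriv (hGg s hs)) (by simp)
  have hm : t ∈ Icc 0 T := Ico_subset_Icc_self ht
  have h1 : HasDerivWithinAt f (g t) (Icc t T) t :=
    ((hd t).congr_deriv (hGg t hm)).hasDerivWithinAt.congr
      (fun s hs => heq ⟨ht.1.trans hs.1, hs.2⟩) (heq hm)
  exact h1.mono_of_mem_nhdsWithin (Icc_mem_nhdsGE ht.2)

end AbsolutelyContinuousOnInterval

theorem ae_mem_Ioo_of_mem_Icc (a b : ℝ) : ∀ᵐ t : ℝ, t ∈ Icc a b → t ∈ Ioo a b := by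
  have h : (Ioo a b : Set ℝ) =ᵐ[volume] Icc a b := Ioo_ae_eq_Icc
  filter_upwards [h.mem_iff] with t ht using ht.2

/-- Equality on a closed interval controls two-sided derivatives only in the interior; the endpoints
form a null set. -/
theorem ae_hasDerivAt_of_eqOn {f g g' : ℝ → ℝ} {a b : ℝ} (h : EqOn f g (Icc a b))
    (hg : ∀ t, HasDerivAt g (g' t) t) : ∀ᵐ t, t ∈ Icc a b → HasDerivAt f (g' t) t := by
  filter_upwards [ae_mem_Ioo_of_mem_Icc a b] with t ht hm
  exact (hg t).congr_of_eventuallyEq ((h.eventuallyEq_of_mem (Icc_mem_nhds (ht hm).1 (ht hm).2)))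

/-! ## Extremals in terms of a normalized covector -/

namespace Heisenberg

variable {n : ℕ}

theorem pontryagin_eq (P : Coord n) (q : Heisenberg n) (w : (Fin n → ℝ) × (Fin n → ℝ)) :
    pontryagin P q w = (∑ i, (P.1 i - P.2.2 / 2 * q.y i) * w.1 i)
      + ∑ i, (P.2.1 i + P.2.2 / 2 * q.x i) * w.2 i := by
  simp only [pontryagin, leftVelocity, sub_mul, add_mul, Finset.sum_add_distrib,
    Finset.sum_sub_distrib, mul_sub, Finset.mul_sum]
  have e1 : ∑ i, P.2.2 / 2 * q.x i * w.2 i = ∑ i, P.2.2 * (1 / 2 * (q.x i * w.2 i)) :=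
    Finset.sum_congr rfl fun i _ => by ring
  have e2 : ∑ i, P.2.2 / 2 * q.y i * w.1 i = ∑ i, P.2.2 * (1 / 2 * (w.1 i * q.y i)) :=
    Finset.sum_congr rfl fun i _ => by ring
  rw [e1, e2]
  ring

theorem hasDerivAt_sum_update (c x v : Fin n → ℝ) (s : ℝ) (i : Fin n) (ξ : ℝ) :
    HasDerivAt (fun ξ => ∑ j, (c j + s * Function.update x i ξ j) * v j) (s * v i) ξ := by
  have h : (fun ξ => ∑ j, (c j + s * Function.update x i ξ j) * v j) =
      fun ξ => (∑ j, (c j + s * x j) * v j) + (ξ - x i) * (s * v i) := by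
    funext ξ
    have : ∀ j, (c j + s * Function.update x i ξ j) * v j
        = (c j + s * x j) * v j + if j = i then (ξ - x i) * (s * v i) else 0 := by
      intro j
      by_cases hj : j = i
      · subst hj; simp; ring
      · simp [hj]
    simp_rw [this, Finset.sum_add_distrib]
    simp
  rw [h]
  simpa using (((hasDerivAt_id ξ).sub_const (x i)).mul_const (s * v i)).const_add
    (∑ j, (c j + s * x j) * v j)

theorem deriv_pontryagin_x (P : Coord n) (q : Heisenberg n) (w : (Fin n → ℝ) × (Fin n → ℝ))
    (i : Fin n) (ξ : ℝ) :
    deriv (fun ξ => pontryagin P ⟨Function.update q.x i ξ, q.y, q.z⟩ w) ξ = P.2.2 / 2 * w.2 i := by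
  simp only [pontryagin_eq]
  exact ((hasDerivAt_sum_update _ _ _ _ _ _).const_add _).deriv

theorem deriv_pontryagin_y (P : Coord n) (q : Heisenberg n) (w : (Fin n → ℝ) × (Fin n → ℝ))
    (i : Fin n) (η : ℝ) :
    deriv (fun η => pontryagin P ⟨q.x, Function.update q.y i η, q.z⟩ w) η
      = -(P.2.2 / 2 * w.1 i) := by
  simp only [pontryagin_eq, sub_eq_add_neg, ← neg_mul]
  exact ((hasDerivAt_sum_update _ _ _ _ _ _).add_const _).deriv

theorem deriv_pontryagin_z (P : Coord n) (q : Heisenberg n) (w : (Fin n → ℝ) × (Fin n → ℝ))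
    (ζ : ℝ) : deriv (fun ζ => pontryagin P ⟨q.x, q.y, ζ⟩ w) ζ = 0 := by
  simp only [pontryagin_eq, deriv_const]

/-- The Pontryagin function along a trajectory through `q`, for a covector that is `(a, b, γ)` at
the origin. -/
noncomputable def reducedPontryagin (a b : Fin n → ℝ) (γ : ℝ) (q : Heisenberg n)
    (w : (Fin n → ℝ) × (Fin n → ℝ)) : ℝ :=
  (∑ i, (a i - γ * q.y i) * w.1 i) + ∑ i, (b i + γ * q.x i) * w.2 i

theorem reducedPontryagin_smul (a b : Fin n → ℝ) (γ c : ℝ) (q : Heisenberg n)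
    (w : (Fin n → ℝ) × (Fin n → ℝ)) :
    reducedPontryagin (c • a) (c • b) (c * γ) q w = c * reducedPontryagin a b γ q w := by
  simp only [reducedPontryagin, mul_add, Finset.mul_sum, Pi.smul_apply, smul_eq_mul]
  congr 1 <;> exact Finset.sum_congr rfl fun i _ => by ring

variable {U : Set ((Fin n → ℝ) × (Fin n → ℝ))} {T : ℝ} {g : ℝ → Heisenberg n}

/-- The adjoint equations read φ_i' = -(γ/2) y_i' and ψ_i' = (γ/2) x_i', and they integrate at once.
The halves γ/2 combine with those in the Pontryagin function, which is why `reducedPontryagin`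
contains γ without the factor 1/2. -/
theorem IsPMPSolution.exists_reduced {w : ℝ → (Fin n → ℝ) × (Fin n → ℝ)} {P : ℝ → Coord n}
    (hT : 0 ≤ T) (h : IsPMPSolution U T g w P) : ∃ (a b : Fin n → ℝ) (γ : ℝ),
      (γ ≠ 0 ∨ a ≠ 0 ∨ b ≠ 0) ∧ ∀ᵐ t, t ∈ Icc 0 T → ∀ w' ∈ U,
        reducedPontryagin a b γ (g t) w' ≤ reducedPontryagin a b γ (g t) (w t) := by
  have htr := h.trajectory
  have hγ : EqOn (fun t => (P t).2.2) (fun _ => (P 0).2.2) (Icc 0 T) := by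
    refine h.ac_gamma.eqOn_of_ae_hasDerivAt hT (.const _) (f' := fun _ => 0) ?_
      (.of_forall fun t _ => hasDerivAt_const t _) rfl
    filter_upwards [h.deriv_gamma] with t ht hm
    simpa [deriv_pontryagin_z] using ht hm
  have hφ : ∀ i, EqOn (fun t => (P t).1 i)
      (fun t => (P 0).1 i - (P 0).2.2 / 2 * (g t).y i) (Icc 0 T) := by
    intro i
    refine (h.ac_phi i).eqOn_of_ae_hasDerivAt hT ((AbsolutelyContinuousOnInterval.const _).sub
      ((htr.ac_y i).const_mul _)) (f' := fun t => -((P 0).2.2 / 2 * (w t).2 i)) ?_ ?_ ?_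
    · filter_upwards [h.deriv_phi i] with t ht hm
      have := ht hm
      rwa [deriv_pontryagin_x, show (P t).2.2 = (P 0).2.2 from hγ hm] at this
    · filter_upwards [htr.deriv_y i] with t ht hm
      exact ((ht hm).const_mul ((P 0).2.2 / 2)).const_sub ((P 0).1 i)
    · simp [htr.initial]
  have hψ : ∀ i, EqOn (fun t => (P t).2.1 i)
      (fun t => (P 0).2.1 i + (P 0).2.2 / 2 * (g t).x i) (Icc 0 T) := by
    intro i
    refine (h.ac_psi i).eqOn_of_ae_hasDerivAt hT ((AbsolutelyContinuousOnInterval.const _).add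
      ((htr.ac_x i).const_mul _)) (f' := fun t => (P 0).2.2 / 2 * (w t).1 i) ?_ ?_ ?_
    · filter_upwards [h.deriv_psi i] with t ht hm
      have := ht hm
      rwa [deriv_pontryagin_y, show (P t).2.2 = (P 0).2.2 from hγ hm, neg_neg] at this
    · filter_upwards [htr.deriv_x i] with t ht hm
      exact ((ht hm).const_mul ((P 0).2.2 / 2)).const_add ((P 0).2.1 i)
    · simp [htr.initial]
  refine ⟨(P 0).1, (P 0).2.1, (P 0).2.2, ?_, ?_⟩
  · by_contra! hc
    exact h.nonzero 0 (left_mem_Icc.2 hT) (Prod.ext hc.2.1 (Prod.ext hc.2.2 hc.1))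
  · filter_upwards [h.maximum] with t ht hm w' hw'
    have key : ∀ w, pontryagin (P t) (g t) w
        = reducedPontryagin (P 0).1 (P 0).2.1 (P 0).2.2 (g t) w := by
      intro w
      rw [pontryagin_eq, reducedPontryagin]
      have e1 : ∀ i, (P t).1 i = _ := fun i => hφ i hm
      have e2 : ∀ i, (P t).2.1 i = _ := fun i => hψ i hm
      have e3 : (P t).2.2 = _ := hγ hm
      simp only [e1, e2, e3]
      congr 1 <;> exact Finset.sum_congr rfl fun i _ => by ring
    rw [← key, ← key]
    exact ht hm w' hw'

/-- Dividing the covector by |γ| > 0 does not change the maximizers. -/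
theorem IsExtremal.exists_normalized (hT : 0 ≤ T) (h : IsExtremal U T g) :
    ∃ (w : ℝ → (Fin n → ℝ) × (Fin n → ℝ)) (a b : Fin n → ℝ) (γ : ℝ),
      IsTrajectory U T g w ∧ (γ = 0 ∨ γ = 1 ∨ γ = -1) ∧ (γ ≠ 0 ∨ a ≠ 0 ∨ b ≠ 0) ∧
      ∀ᵐ t, t ∈ Icc 0 T → ∀ w' ∈ U,
        reducedPontryagin a b γ (g t) w' ≤ reducedPontryagin a b γ (g t) (w t) := by
  obtain ⟨w, P, hP⟩ := h
  obtain ⟨a, b, γ, h0, hmax⟩ := hP.exists_reduced hT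
  by_cases hγ : γ = 0
  · exact ⟨w, a, b, γ, hP.trajectory, Or.inl hγ, h0, hmax⟩
  · have hpos := abs_pos.2 hγ
    refine ⟨w, |γ|⁻¹ • a, |γ|⁻¹ • b, |γ|⁻¹ * γ, hP.trajectory, Or.inr ?_, Or.inl ?_, ?_⟩
    · rcases abs_cases γ with ⟨h1, _⟩ | ⟨h1, _⟩ <;> rw [h1]
      · left; field_simp
      · right; field_simp
    · exact mul_ne_zero (inv_pos.2 hpos).ne' hγ
    · filter_upwards [hmax] with t ht hm w' hw'
      rw [reducedPontryagin_smul, reducedPontryagin_smul]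
      exact mul_le_mul_of_nonneg_left (ht hm w' hw') (inv_pos.2 hpos).le

theorem IsTrajectory.isExtremal {w : ℝ → (Fin n → ℝ) × (Fin n → ℝ)} (h : IsTrajectory U T g w)
    (a b : Fin n → ℝ) (γ : ℝ) (h0 : γ ≠ 0 ∨ a ≠ 0 ∨ b ≠ 0)
    (hmax : ∀ t ∈ Icc 0 T, ∀ w' ∈ U,
      reducedPontryagin a b γ (g t) w' ≤ reducedPontryagin a b γ (g t) (w t)) :
    IsExtremal U T g := by
  -- The covector is the explicit integral of the adjoint equations with initial value (a, b, γ). It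
  -- never vanishes: for γ = 0 it is the constant (a, b, 0).
  refine ⟨w, fun t => (fun i => a i - γ / 2 * (g t).y i, fun i => b i + γ / 2 * (g t).x i, γ), ?_⟩
  exact
    { trajectory := h
      nonzero := by
        intro t _ hP
        have h3 : γ = 0 := congrArg (fun P => P.2.2) hP
        subst h3
        rcases h0 with h0 | h0 | h0
        · exact h0 rfl
        · exact h0 (by simpa using congrArg (fun P => P.1) hP)
        · exact h0 (by simpa using congrArg (fun P => P.2.1) hP)
      ac_phi := fun i => (AbsolutelyContinuousOnInterval.const _).sub ((h.ac_y i).const_mul _)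
      ac_psi := fun i => (AbsolutelyContinuousOnInterval.const _).add ((h.ac_x i).const_mul _)
      ac_gamma := AbsolutelyContinuousOnInterval.const _
      deriv_phi := fun i => by
        filter_upwards [h.deriv_y i] with t ht hm
        rw [deriv_pontryagin_x]
        exact ((ht hm).const_mul (γ / 2)).const_sub (a i)
      deriv_psi := fun i => by
        filter_upwards [h.deriv_x i] with t ht hm
        rw [deriv_pontryagin_y, neg_neg]
        exact ((ht hm).const_mul (γ / 2)).const_add (b i)
      deriv_gamma := .of_forall fun t _ => by
        rw [deriv_pontryagin_z, neg_zero]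
        exact hasDerivAt_const t γ
      maximum := .of_forall fun t ht w' hw' => by
        have key : ∀ w, pontryagin (fun i => a i - γ / 2 * (g t).y i,
            fun i => b i + γ / 2 * (g t).x i, γ) (g t) w = reducedPontryagin a b γ (g t) w := by
          intro w
          rw [pontryagin_eq, reducedPontryagin]
          congr 1 <;> exact Finset.sum_congr rfl fun i _ => by ring
        rw [key, key]
        exact hmax t ht w' hw' }

/-- A curve that agrees on `[0, T]` with a continuously differentiable solution is a trajectory. -/
theorem isTrajectory_of_eqOn {G : ℝ → Heisenberg n} {w : ℝ → (Fin n → ℝ) × (Fin n → ℝ)}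
    (hT : 0 ≤ T) (hw : Continuous w) (hU : ∀ t, w t ∈ U) (h0 : G 0 = 1) (hg : EqOn g G (Icc 0 T))
    (hx : ∀ i t, HasDerivAt (fun s => (G s).x i) ((w t).1 i) t)
    (hy : ∀ i t, HasDerivAt (fun s => (G s).y i) ((w t).2 i) t)
    (hz : ∀ t, HasDerivAt (fun s => (G s).z)
      ((1 / 2) * ((∑ i, (G t).x i * (w t).2 i) - ∑ i, (w t).1 i * (G t).y i)) t) :
    IsTrajectory U T g w := by
  have hX : ∀ i, EqOn (fun t => (G t).x i) (fun t => (g t).x i) (Icc 0 T) := fun i t ht => by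
    simp only [hg ht]
  have hY : ∀ i, EqOn (fun t => (G t).y i) (fun t => (g t).y i) (Icc 0 T) := fun i t ht => by
    simp only [hg ht]
  have hZ : EqOn (fun t => (G t).z) (fun t => (g t).z) (Icc 0 T) := fun t ht => by
    simp only [hg ht]
  have cx : ∀ i, Continuous fun s => (G s).x i := fun i =>
    continuous_iff_continuousAt.2 fun t => (hx i t).continuousAt
  have cy : ∀ i, Continuous fun s => (G s).y i := fun i =>
    continuous_iff_continuousAt.2 fun t => (hy i t).continuousAt
  have cu : ∀ i, Continuous fun s => (w s).1 i := fun i => (continuous_apply i).comp hw.fst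
  have cv : ∀ i, Continuous fun s => (w s).2 i := fun i => (continuous_apply i).comp hw.snd
  have hI := uIcc_of_le hT
  exact
    { measurable_control := hw.measurable
      control_mem := fun t _ => hU t
      initial := by rw [hg (left_mem_Icc.2 hT), h0]
      ac_x := fun i => (AbsolutelyContinuousOnInterval.of_hasDerivAt (hx i) (cu i)).congr_eqOn
        (hI ▸ hX i)
      ac_y := fun i => (AbsolutelyContinuousOnInterval.of_hasDerivAt (hy i) (cv i)).congr_eqOn
        (hI ▸ hY i)
      ac_z := (AbsolutelyContinuousOnInterval.of_hasDerivAt hz (continuous_const.mul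
        ((continuous_finsetSum _ fun i _ => (cx i).mul (cv i)).sub
          (continuous_finsetSum _ fun i _ => (cu i).mul (cy i))))).congr_eqOn (hI ▸ hZ)
      deriv_x := fun i => ae_hasDerivAt_of_eqOn (hX i).symm (hx i)
      deriv_y := fun i => ae_hasDerivAt_of_eqOn (hY i).symm (hy i)
      deriv_z := by
        filter_upwards [ae_hasDerivAt_of_eqOn hZ.symm hz] with t ht hm
        simpa only [leftVelocity, hg hm] using ht hm }

end Heisenberg

end

section

open MeasureTheory Set

/-! ## Optimal controls -/

section OptimalControl

variable {n : ℕ} {p q : ℝ}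

/-- Indexing by `Fin n ⊕ Fin n` turns a pair of vectors into one, so the Hölder lemmas apply. -/
theorem mem_lpUnitBall_iff {w : (Fin n → ℝ) × (Fin n → ℝ)} :
    w ∈ lpUnitBall n p ↔ ∑ j : Fin n ⊕ Fin n, |Sum.elim w.1 w.2 j| ^ p ≤ 1 := by
  simp [lpUnitBall, Fintype.sum_sum_type, Finset.sum_add_distrib]

theorem sum_elim_mul (h k u v : Fin n → ℝ) :
    ∑ j : Fin n ⊕ Fin n, Sum.elim h k j * Sum.elim u v j = ∑ i, h i * u i + ∑ i, k i * v i := by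
  simp [Fintype.sum_sum_type]

theorem sum_elim_rpow (h k : Fin n → ℝ) :
    ∑ j : Fin n ⊕ Fin n, |Sum.elim h k j| ^ q = ∑ i, (|h i| ^ q + |k i| ^ q) := by
  simp [Fintype.sum_sum_type, Finset.sum_add_distrib]

theorem eq_dual_of_isMax (hpq : p.HolderConjugate q) {h k : Fin n → ℝ}
    {w : (Fin n → ℝ) × (Fin n → ℝ)} (hS : 0 < ∑ i, (|h i| ^ q + |k i| ^ q))
    (hw : w ∈ lpUnitBall n p) (hmax : ∀ w' ∈ lpUnitBall n p,
      ∑ i, h i * w'.1 i + ∑ i, k i * w'.2 i ≤ ∑ i, h i * w.1 i + ∑ i, k i * w.2 i) (i : Fin n) :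
    w.1 i = ((∑ i, (|h i| ^ q + |k i| ^ q)) ^ (1 / q)) ^ (-(q / p)) * dualPow q (h i) ∧
    w.2 i = ((∑ i, (|h i| ^ q + |k i| ^ q)) ^ (1 / q)) ^ (-(q / p)) * dualPow q (k i) := by
  have key := eq_dual_of_forall_sum_le hpq (Sum.elim h k) (Sum.elim w.1 w.2)
    (by rwa [sum_elim_rpow]) (mem_lpUnitBall_iff.1 hw) (by
      intro w' hw'
      have := hmax (fun i => w' (.inl i), fun i => w' (.inr i))
        (mem_lpUnitBall_iff.2 (by simpa [Fintype.sum_sum_type] using hw'))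
      rw [sum_elim_mul]
      simpa [Fintype.sum_sum_type] using this)
  rw [sum_elim_rpow] at key
  exact ⟨key (.inl i), key (.inr i)⟩

theorem eq_zero_of_abs_rpow_add_eq_zero (hq : q ≠ 0) {h k : ℝ} (h0 : |h| ^ q + |k| ^ q = 0) :
    h = 0 ∧ k = 0 := by
  have h1 := Real.rpow_nonneg (abs_nonneg h) q
  have h2 := Real.rpow_nonneg (abs_nonneg k) q
  have e1 : |h| ^ q = 0 := by linarith
  have e2 : |k| ^ q = 0 := by linarith
  rw [Real.rpow_eq_zero (abs_nonneg _) hq, abs_eq_zero] at e1 e2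
  exact ⟨e1, e2⟩

/-- Along a maximizing control the planar levels `|h_i| ^ q + |k_i| ^ q` are stationary. -/
theorem dualPow_mul_eq_of_isMax (hpq : p.HolderConjugate q) {h k : Fin n → ℝ}
    {w : (Fin n → ℝ) × (Fin n → ℝ)}
    (hw : w ∈ lpUnitBall n p) (hmax : ∀ w' ∈ lpUnitBall n p,
      ∑ i, h i * w'.1 i + ∑ i, k i * w'.2 i ≤ ∑ i, h i * w.1 i + ∑ i, k i * w.2 i) (i : Fin n) :
    dualPow q (h i) * w.2 i = dualPow q (k i) * w.1 i := by
  have hnn : ∀ j ∈ Finset.univ, 0 ≤ |h j| ^ q + |k j| ^ q := fun j _ => by positivity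
  rcases (Finset.sum_nonneg hnn).eq_or_lt with hS | hS
  -- At a zero covector the maximum condition says nothing about `w`, but both sides vanish anyway.
  · have h0 := (Finset.sum_eq_zero_iff_of_nonneg hnn).1 hS.symm i (Finset.mem_univ i)
    obtain ⟨e1, e2⟩ := eq_zero_of_abs_rpow_add_eq_zero hpq.symm.ne_zero h0
    rw [e1, e2]; simp
  · obtain ⟨h1, h2⟩ := eq_dual_of_isMax hpq hS hw hmax i
    rw [h1, h2]; ring

/-- The control dual to the covector `(A_i c_i, A_i s_i)`. -/
noncomputable def dualControl (p q : ℝ) (A c s : Fin n → ℝ) : (Fin n → ℝ) × (Fin n → ℝ) :=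
  (fun i => A i ^ (q - 1) * lqNorm q A ^ (-(q / p)) * dualPow q (c i),
   fun i => A i ^ (q - 1) * lqNorm q A ^ (-(q / p)) * dualPow q (s i))

theorem abs_mul_rpow_add {a x y : ℝ} (ha : 0 ≤ a) (h : |x| ^ q + |y| ^ q = 1) :
    |a * x| ^ q + |a * y| ^ q = a ^ q := by
  rw [abs_mul, abs_mul, abs_of_nonneg ha, Real.mul_rpow ha (abs_nonneg _),
    Real.mul_rpow ha (abs_nonneg _), ← mul_add, h, mul_one]

variable {A c s : Fin n → ℝ}

theorem sum_abs_mul_rpow (hA : ∀ i, 0 ≤ A i) (hcs : ∀ i, |c i| ^ q + |s i| ^ q = 1) :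
    ∑ i, (|A i * c i| ^ q + |A i * s i| ^ q) = ∑ i, A i ^ q :=
  Finset.sum_congr rfl fun i _ => abs_mul_rpow_add (hA i) (hcs i)

theorem sum_rpow_pos_or_eq_zero (hq : q ≠ 0) (hA : ∀ i, 0 ≤ A i) : 0 < ∑ i, A i ^ q ∨ A = 0 := by
  have hnn : ∀ j ∈ Finset.univ, 0 ≤ A j ^ q := fun j _ => Real.rpow_nonneg (hA j) q
  rcases (Finset.sum_nonneg hnn).eq_or_lt with hS | hS
  · right
    funext i
    have h0 := (Finset.sum_eq_zero_iff_of_nonneg hnn).1 hS.symm i (Finset.mem_univ i)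
    exact (Real.rpow_eq_zero (hA i) hq).1 h0
  · exact Or.inl hS

theorem dualControl_eq (hpq : p.HolderConjugate q) (hA : ∀ i, 0 ≤ A i) : dualControl p q A c s =
    (fun i => lqNorm q A ^ (-(q / p)) * dualPow q (A i * c i),
     fun i => lqNorm q A ^ (-(q / p)) * dualPow q (A i * s i)) := by
  simp only [dualControl, dualPow_mul hpq.symm.lt (hA _)]
  ext i <;> simp only <;> ring

theorem dualControl_eq_zero (hpq : p.HolderConjugate q) :
    dualControl p q (0 : Fin n → ℝ) c s = 0 := by
  have := hpq.symm.sub_one_ne_zero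
  ext i <;> simp [dualControl, Real.zero_rpow this]

theorem dualControl_mem (hpq : p.HolderConjugate q) (hA : ∀ i, 0 ≤ A i)
    (hcs : ∀ i, |c i| ^ q + |s i| ^ q = 1) : dualControl p q A c s ∈ lpUnitBall n p := by
  rcases sum_rpow_pos_or_eq_zero hpq.symm.ne_zero hA with hS | rfl
  · rw [← sum_abs_mul_rpow hA hcs, ← sum_elim_rpow] at hS
    have h1 := sum_abs_dual_rpow hpq _ hS
    rw [sum_elim_rpow, sum_abs_mul_rpow hA hcs] at h1
    rw [mem_lpUnitBall_iff, dualControl_eq hpq hA, ← h1]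
    refine le_of_eq (Finset.sum_congr rfl ?_)
    rintro (i | i) _ <;> rfl
  · rw [dualControl_eq_zero hpq]
    simp [lpUnitBall, Real.zero_rpow hpq.ne_zero]

theorem dualControl_isMax (hpq : p.HolderConjugate q) (hA : ∀ i, 0 ≤ A i)
    (hcs : ∀ i, |c i| ^ q + |s i| ^ q = 1) {w' : (Fin n → ℝ) × (Fin n → ℝ)}
    (hw' : w' ∈ lpUnitBall n p) :
    ∑ i, A i * c i * w'.1 i + ∑ i, A i * s i * w'.2 i ≤
      ∑ i, A i * c i * (dualControl p q A c s).1 i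
        + ∑ i, A i * s i * (dualControl p q A c s).2 i := by
  rcases sum_rpow_pos_or_eq_zero hpq.symm.ne_zero hA with hS | rfl
  · have h2 := sum_mul_le_of_sum_rpow_le_one hpq (Sum.elim (fun i => A i * c i) fun i => A i * s i)
      _ (mem_lpUnitBall_iff.1 hw')
    rw [← sum_abs_mul_rpow hA hcs, ← sum_elim_rpow] at hS
    have h1 := sum_mul_dual hpq _ hS
    rw [sum_elim_mul] at h2
    refine h2.trans (le_of_eq ?_)
    rw [← h1, sum_elim_rpow, sum_abs_mul_rpow hA hcs, dualControl_eq hpq hA,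
      Fintype.sum_sum_type]
    rfl
  · simp

theorem eq_dualControl_of_isMax (hpq : p.HolderConjugate q) (hA : ∀ i, 0 ≤ A i) (hA0 : A ≠ 0)
    (hcs : ∀ i, |c i| ^ q + |s i| ^ q = 1) {w : (Fin n → ℝ) × (Fin n → ℝ)}
    (hw : w ∈ lpUnitBall n p) (hmax : ∀ w' ∈ lpUnitBall n p,
      ∑ i, A i * c i * w'.1 i + ∑ i, A i * s i * w'.2 i ≤
        ∑ i, A i * c i * w.1 i + ∑ i, A i * s i * w.2 i) : w = dualControl p q A c s := by
  have hS := (sum_rpow_pos_or_eq_zero hpq.symm.ne_zero hA).resolve_right hA0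
  rw [← sum_abs_mul_rpow hA hcs] at hS
  have key := eq_dual_of_isMax hpq hS hw hmax
  rw [sum_abs_mul_rpow hA hcs] at key
  rw [dualControl_eq hpq hA]
  ext i
  exacts [(key i).1, (key i).2]

/-- Polar coordinates with respect to Shelupsky's functions. -/
theorem exists_polar (hq : 0 < q) (h k : ℝ) :
    ∃ A, 0 ≤ A ∧ ∃ θ, h = A * cosLp q θ ∧ k = A * sinLp q θ := by
  set S := |h| ^ q + |k| ^ q with hS
  have hS0 : 0 ≤ S := by positivity
  refine ⟨S ^ (1 / q), by positivity, ?_⟩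
  rcases hS0.eq_or_lt with h0 | h0
  · obtain ⟨e1, e2⟩ := eq_zero_of_abs_rpow_add_eq_zero hq.ne' h0.symm
    refine ⟨0, ?_⟩
    rw [← h0, Real.zero_rpow (by positivity), e1, e2]
    simp
  · have hα : 0 < S ^ (1 / q) := by positivity
    have hαq : (S ^ (1 / q)) ^ q = S := by
      rw [← Real.rpow_mul hS0, one_div_mul_cancel hq.ne', Real.rpow_one]
    obtain ⟨θ, h1, h2⟩ := exists_lpAngle hq (h := (S ^ (1 / q))⁻¹ * h)
        (k := (S ^ (1 / q))⁻¹ * k) (by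
      rw [abs_mul, abs_mul, abs_of_pos (inv_pos.2 hα),
        Real.mul_rpow (inv_pos.2 hα).le (abs_nonneg _),
        Real.mul_rpow (inv_pos.2 hα).le (abs_nonneg _), ← mul_add, ← hS,
        Real.inv_rpow hα.le, hαq,
        inv_mul_cancel₀ h0.ne'])
    exact ⟨θ, by rw [h1, mul_inv_cancel_left₀ hα.ne'], by rw [h2, mul_inv_cancel_left₀ hα.ne']⟩

theorem mem_frontier_lpDisc_iff (hp : 0 < p) {w : ℝ × ℝ} :
    w ∈ frontier (lpDisc p) ↔ |w.1| ^ p + |w.2| ^ p = 1 := by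
  have hc : Continuous fun w : ℝ × ℝ => |w.1| ^ p + |w.2| ^ p :=
    ((continuous_fst.abs.rpow_const fun _ => Or.inr hp.le).add
      (continuous_snd.abs.rpow_const fun _ => Or.inr hp.le))
  constructor
  · intro h
    exact frontier_le_subset_eq hc continuous_const h
  · intro h
    refine ⟨subset_closure (show w ∈ lpDisc p from h.le), fun hi => ?_⟩
    -- Scaling radially by a factor slightly above 1 leaves the disc, so a point of level 1 is not
    -- interior.
    have hs : Continuous fun t : ℝ => t • w := by fun_prop
    have h1 : ∀ᶠ t in nhds (1 : ℝ), t • w ∈ lpDisc p :=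
      hs.continuousAt.eventually (by
        simp only [one_smul]; exact mem_interior_iff_mem_nhds.1 hi)
    obtain ⟨ε, hε, h2⟩ := Metric.eventually_nhds_iff.1 h1
    have h3 : (1 + ε / 2) • w ∈ lpDisc p := h2 (by
      rw [Real.dist_eq, add_sub_cancel_left, abs_of_pos (by positivity)]; linarith)
    have h4 : |(1 + ε / 2) * w.1| ^ p + |(1 + ε / 2) * w.2| ^ p ≤ 1 := h3
    rw [abs_mul_rpow_add (by positivity) h] at h4
    exact absurd h4 (not_le.2 (Real.one_lt_rpow (by linarith) hp))

/-- With S the sum of the A_i^q, this is S · S^(-1/p) = S^(1/q); it is the source of the term γ α t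
in 2z. -/
theorem sum_rpow_mul_lqNorm (hpq : p.HolderConjugate q) (hA : ∀ i, 0 ≤ A i) :
    (∑ i, A i ^ q) * lqNorm q A ^ (-(q / p)) = lqNorm q A := by
  rcases sum_rpow_pos_or_eq_zero hpq.symm.ne_zero hA with hS | rfl
  · rw [lqNorm, ← Real.rpow_mul hS.le]
    nth_rw 1 [← Real.rpow_one (∑ i, A i ^ q)]
    rw [← Real.rpow_add hS, hpq.div_eq_sub_one]
    have := hpq.symm.ne_zero
    congr 1
    field_simp
    ring
  · simp [lqNorm, Real.zero_rpow hpq.symm.ne_zero, Real.zero_rpow (inv_ne_zero hpq.symm.ne_zero)]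

end OptimalControl

/-! ## The explicit trajectories -/

section Explicit

variable {n : ℕ} {p q : ℝ}

/-- The explicit trajectory for `γ = ± 1`. -/
noncomputable def curvedCurve (p q γ : ℝ) (A θ₀ : Fin n → ℝ) (t : ℝ) : Heisenberg n where
  x i := γ * A i * (sinLp q (linearAngle p q γ A θ₀ i t) - sinLp q (θ₀ i))
  y i := γ * A i * (cosLp q (θ₀ i) - cosLp q (linearAngle p q γ A θ₀ i t))
  z := (1 / 2) * (γ * lqNorm q A * t + ∑ i, A i ^ 2 *
      (sinLp q (θ₀ i) * cosLp q (linearAngle p q γ A θ₀ i t)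
        - cosLp q (θ₀ i) * sinLp q (linearAngle p q γ A θ₀ i t)))

/-- The control of `curvedCurve`. -/
noncomputable def curvedControl (p q γ : ℝ) (A θ₀ : Fin n → ℝ) (t : ℝ) :
    (Fin n → ℝ) × (Fin n → ℝ) :=
  dualControl p q A (fun i => cosLp q (linearAngle p q γ A θ₀ i t))
    fun i => sinLp q (linearAngle p q γ A θ₀ i t)

variable {γ : ℝ} {A θ₀ : Fin n → ℝ}

theorem linearAngle_zero (i : Fin n) : linearAngle p q γ A θ₀ i 0 = θ₀ i := by
  simp [linearAngle]

theorem curvedCurve_zero : curvedCurve p q γ A θ₀ 0 = 1 := by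
  ext i
  · simp [curvedCurve, linearAngle_zero]
  · simp [curvedCurve, linearAngle_zero]
  · simp [curvedCurve, linearAngle_zero, mul_comm]

theorem hasDerivAt_linearAngle (i : Fin n) (t : ℝ) :
    HasDerivAt (linearAngle p q γ A θ₀ i) (γ * A i ^ (q - 2) * lqNorm q A ^ (-(q / p))) t := by
  refine HasDerivAt.congr_deriv (f' := γ * A i ^ (q - 2) * lqNorm q A ^ (-(q / p)) * 1) ?_
    (mul_one _)
  exact ((hasDerivAt_id t).const_mul
    (γ * A i ^ (q - 2) * lqNorm q A ^ (-(q / p)))).const_add (θ₀ i)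

theorem mul_rpow_sub_two (hq : 1 < q) {a : ℝ} (ha : 0 ≤ a) : a * a ^ (q - 2) = a ^ (q - 1) := by
  rw [← dualPow_of_nonneg hq ha, dualPow, abs_of_nonneg ha, mul_comm]

theorem sq_mul_rpow_sub_two (hq : 1 < q) {a : ℝ} (ha : 0 ≤ a) : a ^ 2 * a ^ (q - 2) = a ^ q := by
  rw [sq, mul_assoc, mul_rpow_sub_two hq ha, ← dualPow_of_nonneg hq ha, mul_dualPow hq,
    abs_of_nonneg ha]

theorem hasDerivAt_cosLp_linearAngle (hq : 1 < q) (i : Fin n) (t : ℝ) :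
    HasDerivAt (fun t => cosLp q (linearAngle p q γ A θ₀ i t))
      (-dualPow q (sinLp q (linearAngle p q γ A θ₀ i t)) *
        (γ * A i ^ (q - 2) * lqNorm q A ^ (-(q / p)))) t :=
  HasDerivAt.comp (h₂ := cosLp q) t (hasDerivAt_cosLp hq _) (hasDerivAt_linearAngle i t)

theorem hasDerivAt_sinLp_linearAngle (hq : 1 < q) (i : Fin n) (t : ℝ) :
    HasDerivAt (fun t => sinLp q (linearAngle p q γ A θ₀ i t))
      (dualPow q (cosLp q (linearAngle p q γ A θ₀ i t)) *
        (γ * A i ^ (q - 2) * lqNorm q A ^ (-(q / p)))) t :=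
  HasDerivAt.comp (h₂ := sinLp q) t (hasDerivAt_sinLp hq _) (hasDerivAt_linearAngle i t)

theorem continuous_curvedControl (hq : 1 < q) : Continuous (curvedControl p q γ A θ₀) := by
  have h0 : 0 < q := by linarith
  have hl : ∀ i, Continuous (linearAngle p q γ A θ₀ i) := fun i =>
    continuous_iff_continuousAt.2 fun t => (hasDerivAt_linearAngle i t).continuousAt
  refine Continuous.prodMk (continuous_pi fun i => ?_) (continuous_pi fun i => ?_)
  · exact continuous_const.mul ((continuous_dualPow hq).comp ((continuous_cosLp h0).comp (hl i)))
  · exact continuous_const.mul ((continuous_dualPow hq).comp ((continuous_sinLp h0).comp (hl i)))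

theorem hasDerivAt_curvedCurve_x (hq : 1 < q) (hγ : γ ^ 2 = 1) (hA : ∀ i, 0 ≤ A i) (i : Fin n)
    (t : ℝ) : HasDerivAt (fun t => (curvedCurve p q γ A θ₀ t).x i)
      ((curvedControl p q γ A θ₀ t).1 i) t := by
  refine (((hasDerivAt_sinLp_linearAngle hq i t).sub_const _).const_mul _).congr_deriv ?_
  simp only [curvedControl, dualControl, ← mul_rpow_sub_two hq (hA i)]
  linear_combination (A i * A i ^ (q - 2) * lqNorm q A ^ (-(q / p)) *
    dualPow q (cosLp q (linearAngle p q γ A θ₀ i t))) * hγ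

theorem hasDerivAt_curvedCurve_y (hq : 1 < q) (hγ : γ ^ 2 = 1) (hA : ∀ i, 0 ≤ A i) (i : Fin n)
    (t : ℝ) : HasDerivAt (fun t => (curvedCurve p q γ A θ₀ t).y i)
      ((curvedControl p q γ A θ₀ t).2 i) t := by
  refine (((hasDerivAt_cosLp_linearAngle hq i t).const_sub _).const_mul _).congr_deriv ?_
  simp only [curvedControl, dualControl, ← mul_rpow_sub_two hq (hA i)]
  linear_combination (A i * A i ^ (q - 2) * lqNorm q A ^ (-(q / p)) *
    dualPow q (sinLp q (linearAngle p q γ A θ₀ i t))) * hγ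

/-- Write c, s for cos_q θ_i, sin_q θ_i, with subscript 0 at θ_{i0}, and L = α^(-q/p). The i-th area
term is γ A_i^q L (c c* + s s* - c_0 c* - s_0 s*). The first two products add to 1 and sum over i to
γ α, and the other two come from differentiating the explicit sum. -/
theorem hasDerivAt_curvedCurve_z (hpq : p.HolderConjugate q) (hA : ∀ i, 0 ≤ A i) (t : ℝ) :
    HasDerivAt (fun t => (curvedCurve p q γ A θ₀ t).z)
      ((1 / 2) * ((∑ i, (curvedCurve p q γ A θ₀ t).x i * (curvedControl p q γ A θ₀ t).2 i)
        - ∑ i, (curvedControl p q γ A θ₀ t).1 i * (curvedCurve p q γ A θ₀ t).y i)) t := by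
  have hq := hpq.symm.lt
  have h1 : HasDerivAt (fun t : ℝ => γ * lqNorm q A * t) (γ * lqNorm q A * 1) t :=
    (hasDerivAt_id t).const_mul _
  have h2 := HasDerivAt.fun_sum (u := Finset.univ) fun i (_ : i ∈ Finset.univ) =>
    (((hasDerivAt_cosLp_linearAngle (p := p) (γ := γ) (A := A) (θ₀ := θ₀) hq i t).const_mul
      (sinLp q (θ₀ i))).fun_sub ((hasDerivAt_sinLp_linearAngle (p := p) (γ := γ) (A := A)
        (θ₀ := θ₀) hq i t).const_mul (cosLp q (θ₀ i)))).const_mul (A i ^ 2)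
  refine ((h1.add h2).const_mul (1 / 2)).congr_deriv ?_
  congr 1
  have hN := sum_rpow_mul_lqNorm hpq hA
  simp only [curvedControl, dualControl, curvedCurve]
  generalize lqNorm q A ^ (-(q / p)) = L at hN ⊢
  rw [← Finset.sum_sub_distrib, ← hN, Finset.sum_mul, mul_one, Finset.mul_sum,
    ← Finset.sum_add_distrib]
  refine Finset.sum_congr rfl fun i _ => ?_
  have hid := abs_cosLp_rpow_add_abs_sinLp_rpow (r := q) (by linarith)
    (linearAngle p q γ A θ₀ i t)
  rw [← mul_dualPow hq, ← mul_dualPow hq] at hid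
  rw [← sq_mul_rpow_sub_two hq (hA i), ← mul_rpow_sub_two hq (hA i)]
  linear_combination (-γ * A i ^ 2 * A i ^ (q - 2) * L) * hid

/-- Since γ² = 1, the initial values cancel in a_i - γ y_i and b_i + γ x_i, leaving the rotating
covector A_i (cos_q θ_i, sin_q θ_i). -/
theorem reducedPontryagin_curvedCurve (hγ : γ ^ 2 = 1) (t : ℝ) (w : (Fin n → ℝ) × (Fin n → ℝ)) :
    Heisenberg.reducedPontryagin (fun i => A i * cosLp q (θ₀ i)) (fun i => A i * sinLp q (θ₀ i)) γ
      (curvedCurve p q γ A θ₀ t) w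
      = ∑ i, A i * cosLp q (linearAngle p q γ A θ₀ i t) * w.1 i
        + ∑ i, A i * sinLp q (linearAngle p q γ A θ₀ i t) * w.2 i := by
  rw [Heisenberg.reducedPontryagin]
  simp only [curvedCurve]
  congr 1 <;> refine Finset.sum_congr rfl fun i _ => ?_ <;> congr 1
  · linear_combination (A i * cosLp q (linearAngle p q γ A θ₀ i t) - A i * cosLp q (θ₀ i)) * hγ
  · linear_combination (A i * sinLp q (linearAngle p q γ A θ₀ i t) - A i * sinLp q (θ₀ i)) * hγ

theorem isCurvedForm_iff {T : ℝ} {g : ℝ → Heisenberg n} (hA : ∀ i, 0 ≤ A i) :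
    IsCurvedForm p q T γ A g ↔ ∃ θ₀, EqOn g (curvedCurve p q γ A θ₀) (Icc 0 T) := by
  refine exists_congr fun θ₀ => forall₂_congr fun t _ => ?_
  constructor
  · rintro ⟨h1, h2, h3⟩
    ext i
    · rcases (hA i).eq_or_lt with h0 | h0
      · simp [curvedCurve, (h2 i h0.symm).1, ← h0]
      · exact (h1 i h0).1
    · rcases (hA i).eq_or_lt with h0 | h0
      · simp [curvedCurve, (h2 i h0.symm).2, ← h0]
      · exact (h1 i h0).2
    · simp only [curvedCurve]; linarith
  · intro h
    rw [h]
    refine ⟨fun i _ => ⟨rfl, rfl⟩, fun i h0 => ?_, ?_⟩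
    · simp [curvedCurve, h0]
    · simp only [curvedCurve]; ring

theorem isTrajectory_curvedCurve (hpq : p.HolderConjugate q) {T : ℝ} (hT : 0 ≤ T)
    {g : ℝ → Heisenberg n} (hγ : γ ^ 2 = 1) (hA : ∀ i, 0 ≤ A i)
    (hg : EqOn g (curvedCurve p q γ A θ₀) (Icc 0 T)) :
    Heisenberg.IsTrajectory (lpUnitBall n p) T g (curvedControl p q γ A θ₀) :=
  Heisenberg.isTrajectory_of_eqOn hT (continuous_curvedControl hpq.symm.lt)
    (fun t => dualControl_mem hpq hA fun i => abs_cosLp_rpow_add_abs_sinLp_rpow hpq.symm.pos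
      (linearAngle p q γ A θ₀ i t)) curvedCurve_zero hg
    (hasDerivAt_curvedCurve_x hpq.symm.lt hγ hA) (hasDerivAt_curvedCurve_y hpq.symm.lt hγ hA)
    (hasDerivAt_curvedCurve_z hpq hA)

theorem isExtremal_of_eqOn_curvedCurve (hpq : p.HolderConjugate q) {T : ℝ} (hT : 0 ≤ T)
    {g : ℝ → Heisenberg n} (hγ : γ ^ 2 = 1) (hA : ∀ i, 0 ≤ A i)
    (hg : EqOn g (curvedCurve p q γ A θ₀) (Icc 0 T)) :
    Heisenberg.IsExtremal (lpUnitBall n p) T g := by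
  refine (isTrajectory_curvedCurve hpq hT hγ hA hg).isExtremal (fun i => A i * cosLp q (θ₀ i))
    (fun i => A i * sinLp q (θ₀ i)) γ (Or.inl fun h => by simp [h] at hγ) ?_
  intro t ht w' hw'
  rw [hg ht, reducedPontryagin_curvedCurve hγ, reducedPontryagin_curvedCurve hγ]
  exact dualControl_isMax hpq hA (fun i => abs_cosLp_rpow_add_abs_sinLp_rpow hpq.symm.pos
    (linearAngle p q γ A θ₀ i t)) hw'

end Explicit

end

/-! ### Straight extremals, and the passage from the maximum condition to explicit curves. -/

section

open MeasureTheory Set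

section Straight

variable {n : ℕ} {p q : ℝ} {A c s : Fin n → ℝ} {T : ℝ} {g : ℝ → Heisenberg n}

/-- The explicit trajectory for `γ = 0`: a one-parameter subgroup. -/
noncomputable def straightCurve (w : (Fin n → ℝ) × (Fin n → ℝ)) (t : ℝ) : Heisenberg n where
  x i := w.1 i * t
  y i := w.2 i * t
  z := 0

theorem isTrajectory_straightCurve {U : Set ((Fin n → ℝ) × (Fin n → ℝ))}
    {w : (Fin n → ℝ) × (Fin n → ℝ)} (hT : 0 ≤ T) (hw : w ∈ U)
    (hg : EqOn g (straightCurve w) (Icc 0 T)) : Heisenberg.IsTrajectory U T g fun _ => w := by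
  refine Heisenberg.isTrajectory_of_eqOn hT continuous_const (fun _ => hw) ?_ hg
    (fun i t => ?_) (fun i t => ?_) fun t => ?_
  · ext <;> simp [straightCurve]
  · exact ((hasDerivAt_id t).const_mul (w.1 i)).congr_deriv (mul_one _)
  · exact ((hasDerivAt_id t).const_mul (w.2 i)).congr_deriv (mul_one _)
  · refine (hasDerivAt_const t (0 : ℝ)).congr_deriv ?_
    rw [← Finset.sum_sub_distrib, Finset.sum_eq_zero, mul_zero]
    intro i _
    simp only [straightCurve]
    ring

theorem isStraightForm_iff (hpq : p.HolderConjugate q) (hA : ∀ i, 0 ≤ A i) :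
    IsStraightForm p q T A g ↔ ∃ c s : Fin n → ℝ, (∀ i, |c i| ^ q + |s i| ^ q = 1) ∧
      EqOn g (straightCurve (dualControl p q A c s)) (Icc 0 T) := by
  have hq1 := hpq.symm.sub_one_ne_zero
  constructor
  · rintro ⟨u, v, huv, hg⟩
    -- Odd powers exchange the boundaries of the L_p and L_q discs. Where A_i = 0 any point of the
    -- L_q circle will do, here (1, 0), because A_i^(q-1) = 0.
    refine ⟨fun i => if 0 < A i then dualPow p (u i) else 1,
      fun i => if 0 < A i then dualPow p (v i) else 0, fun i => ?_, fun t ht => ?_⟩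
    · by_cases h0 : 0 < A i
      · simpa [h0, abs_dualPow_rpow hpq.symm] using
          (mem_frontier_lpDisc_iff hpq.pos).1 (huv i h0)
      · simp [h0, Real.zero_rpow hpq.symm.ne_zero]
    · obtain ⟨h1, h2, h3⟩ := hg t ht
      ext i
      · rcases (hA i).eq_or_lt with h0 | h0
        · simp [straightCurve, dualControl, ← h0, Real.zero_rpow hq1, h2 i h0.symm]
        · simp [straightCurve, dualControl, h0, dualPow_dualPow hpq.symm, h1 i h0]
      · rcases (hA i).eq_or_lt with h0 | h0
        · simp [straightCurve, dualControl, ← h0, Real.zero_rpow hq1, h2 i h0.symm]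
        · simp [straightCurve, dualControl, h0, dualPow_dualPow hpq.symm, h1 i h0]
      · exact h3
  · rintro ⟨c, s, hcs, hg⟩
    refine ⟨fun i => dualPow q (c i), fun i => dualPow q (s i), fun i _ => ?_, fun t ht => ?_⟩
    · rw [mem_frontier_lpDisc_iff hpq.pos]
      simpa only [abs_dualPow_rpow hpq] using hcs i
    · rw [hg ht]
      refine ⟨fun i _ => ⟨rfl, rfl⟩, fun i h0 => ?_, rfl⟩
      simp [straightCurve, dualControl, h0, Real.zero_rpow hq1]

theorem isExtremal_of_eqOn_straightCurve (hpq : p.HolderConjugate q) (hT : 0 ≤ T)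
    (hA : ∀ i, 0 ≤ A i) (hA0 : A ≠ 0) (hcs : ∀ i, |c i| ^ q + |s i| ^ q = 1)
    (hg : EqOn g (straightCurve (dualControl p q A c s)) (Icc 0 T)) :
    Heisenberg.IsExtremal (lpUnitBall n p) T g := by
  refine (isTrajectory_straightCurve hT (dualControl_mem hpq hA hcs) hg).isExtremal
    (fun i => A i * c i) (fun i => A i * s i) 0 (Or.inr ?_) fun t _ w' hw' => ?_
  · by_contra! hc
    refine hA0 (funext fun i => ?_)
    have h1 : A i * c i = 0 := congrFun hc.1 i
    have h2 : A i * s i = 0 := congrFun hc.2 i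
    have h3 := abs_mul_rpow_add (hA i) (hcs i)
    rw [h1, h2, abs_zero, Real.zero_rpow hpq.symm.ne_zero, add_zero, eq_comm,
      Real.rpow_eq_zero (hA i) hpq.symm.ne_zero] at h3
    exact h3
  · simpa only [Heisenberg.reducedPontryagin, zero_mul, sub_zero, add_zero] using
      dualControl_isMax hpq hA hcs hw'

end Straight

/-- Trajectories with almost everywhere equal controls agree. -/
theorem Heisenberg.IsTrajectory.eqOn {n : ℕ} {U U' : Set ((Fin n → ℝ) × (Fin n → ℝ))} {T : ℝ}
    {g g' : ℝ → Heisenberg n} {w w' : ℝ → (Fin n → ℝ) × (Fin n → ℝ)} (hT : 0 ≤ T)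
    (h : IsTrajectory U T g w) (h' : IsTrajectory U' T g' w')
    (hw : ∀ᵐ t, t ∈ Icc 0 T → w t = w' t) : EqOn g g' (Icc 0 T) := by
  have hx : ∀ i, EqOn (fun t => (g t).x i) (fun t => (g' t).x i) (Icc 0 T) := fun i => by
    refine (h.ac_x i).eqOn_of_ae_hasDerivAt hT (h'.ac_x i) (h.deriv_x i) ?_
      (by simp [h.initial, h'.initial])
    filter_upwards [h'.deriv_x i, hw] with t h1 h2 hm
    rw [h2 hm]
    exact h1 hm
  have hy : ∀ i, EqOn (fun t => (g t).y i) (fun t => (g' t).y i) (Icc 0 T) := fun i => by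
    refine (h.ac_y i).eqOn_of_ae_hasDerivAt hT (h'.ac_y i) (h.deriv_y i) ?_
      (by simp [h.initial, h'.initial])
    filter_upwards [h'.deriv_y i, hw] with t h1 h2 hm
    rw [h2 hm]
    exact h1 hm
  have hz : EqOn (fun t => (g t).z) (fun t => (g' t).z) (Icc 0 T) := by
    refine h.ac_z.eqOn_of_ae_hasDerivAt hT h'.ac_z h.deriv_z ?_ (by simp [h.initial, h'.initial])
    filter_upwards [h'.deriv_z, hw] with t h1 h2 hm
    have e1 : ∀ i, (g t).x i = (g' t).x i := fun i => hx i hm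
    have e2 : ∀ i, (g t).y i = (g' t).y i := fun i => hy i hm
    simp only [leftVelocity, e1, e2, h2 hm]
    exact h1 hm
  intro t ht
  ext i
  exacts [hx i ht, hy i ht, hz ht]

section Forward

variable {n : ℕ} {p q γ T : ℝ} {a b : Fin n → ℝ} {g : ℝ → Heisenberg n}
  {w : ℝ → (Fin n → ℝ) × (Fin n → ℝ)}

/-- For γ = 0 the covector is the constant (a, b) ≠ 0, so its unique maximizer fixes the control
almost everywhere. -/
theorem exists_straightCurve_of_isMax (hpq : p.HolderConjugate q) (hT : 0 ≤ T)
    (htr : Heisenberg.IsTrajectory (lpUnitBall n p) T g w) (hab : a ≠ 0 ∨ b ≠ 0)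
    (hmax : ∀ᵐ t, t ∈ Icc 0 T → ∀ w' ∈ lpUnitBall n p,
      Heisenberg.reducedPontryagin a b 0 (g t) w' ≤
        Heisenberg.reducedPontryagin a b 0 (g t) (w t)) :
    ∃ A : Fin n → ℝ, (∀ i, 0 ≤ A i) ∧ A ≠ 0 ∧ ∃ c s : Fin n → ℝ,
      (∀ i, |c i| ^ q + |s i| ^ q = 1) ∧
      EqOn g (straightCurve (dualControl p q A c s)) (Icc 0 T) := by
  choose A hA θ ha hb using fun i => exists_polar hpq.symm.pos (a i) (b i)
  have hcs := fun i => abs_cosLp_rpow_add_abs_sinLp_rpow hpq.symm.pos (θ i)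
  have hA0 : A ≠ 0 := by
    rintro rfl
    rcases hab with h | h
    · exact h (funext fun i => by simp [ha])
    · exact h (funext fun i => by simp [hb])
  refine ⟨A, hA, hA0, _, _, hcs, htr.eqOn hT (isTrajectory_straightCurve hT
    (dualControl_mem hpq hA hcs) fun _ _ => rfl) ?_⟩
  filter_upwards [hmax] with t ht hm
  refine eq_dualControl_of_isMax hpq hA hA0 hcs (htr.control_mem t hm) fun w' hw' => ?_
  simpa only [Heisenberg.reducedPontryagin, zero_mul, sub_zero, add_zero, ha, hb] using
    ht hm w' hw'

/-- The level has derivative -qγ (h_i* w.2_i - k_i* w.1_i), which vanishes for a maximizing control.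
No nonvanishing of (h, k) is needed, so conservation is available before the control is known. -/
theorem level_eq_of_isMax (hpq : p.HolderConjugate q) (hT : 0 ≤ T)
    (htr : Heisenberg.IsTrajectory (lpUnitBall n p) T g w)
    (hmax : ∀ᵐ t, t ∈ Icc 0 T → ∀ w' ∈ lpUnitBall n p,
      Heisenberg.reducedPontryagin a b γ (g t) w' ≤
        Heisenberg.reducedPontryagin a b γ (g t) (w t)) (i : Fin n) {t : ℝ} (ht : t ∈ Icc 0 T) :
    |a i - γ * (g t).y i| ^ q + |b i + γ * (g t).x i| ^ q = |a i| ^ q + |b i| ^ q := by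
  have hq := hpq.symm.lt
  have hH : AbsolutelyContinuousOnInterval (fun t => a i - γ * (g t).y i) 0 T :=
    (AbsolutelyContinuousOnInterval.const _).sub ((htr.ac_y i).const_mul _)
  have hK : AbsolutelyContinuousOnInterval (fun t => b i + γ * (g t).x i) 0 T :=
    (AbsolutelyContinuousOnInterval.const _).add ((htr.ac_x i).const_mul _)
  have key := ((hH.contDiff_comp (contDiff_abs_rpow hq)).fun_add
    (hK.contDiff_comp (contDiff_abs_rpow hq))).eqOn_of_ae_hasDerivAt hT
    (.const (|a i| ^ q + |b i| ^ q)) (f' := fun _ => 0) ?_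
    (.of_forall fun t _ => hasDerivAt_const t _) (by simp [htr.initial])
  · exact key ht
  · filter_upwards [hmax, htr.deriv_x i, htr.deriv_y i] with t h1 h2 h3 hm
    have d1 := (hasDerivAt_abs_rpow_dualPow hq (a i - γ * (g t).y i)).comp t
      (((h3 hm).const_mul γ).const_sub (a i))
    have d2 := (hasDerivAt_abs_rpow_dualPow hq (b i + γ * (g t).x i)).comp t
      (((h2 hm).const_mul γ).const_add (b i))
    refine (d1.add d2).congr_deriv ?_
    have hst := dualPow_mul_eq_of_isMax hpq (h := fun i => a i - γ * (g t).y i)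
      (k := fun i => b i + γ * (g t).x i) (htr.control_mem t hm) (h1 hm) i
    simp only [Heisenberg.leftVelocity]
    linear_combination (-q * γ) * hst

theorem covector_eq_of_isMax (hpq : p.HolderConjugate q) (hT : 0 ≤ T)
    (htr : Heisenberg.IsTrajectory (lpUnitBall n p) T g w)
    (hmax : ∀ᵐ t, t ∈ Icc 0 T → ∀ w' ∈ lpUnitBall n p,
      Heisenberg.reducedPontryagin a b γ (g t) w' ≤
        Heisenberg.reducedPontryagin a b γ (g t) (w t))
    {A θ₀ : Fin n → ℝ} (hA : ∀ i, 0 ≤ A i) (ha : ∀ i, a i = A i * cosLp q (θ₀ i))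
    (hb : ∀ i, b i = A i * sinLp q (θ₀ i)) (i : Fin n) {t : ℝ} (ht : t ∈ Icc 0 T) :
    a i - γ * (g t).y i = A i * cosLp q (linearAngle p q γ A θ₀ i t) ∧
    b i + γ * (g t).x i = A i * sinLp q (linearAngle p q γ A θ₀ i t) := by
  have hq := hpq.symm.lt
  have hlevel : ∀ i, ∀ t ∈ Icc 0 T,
      |a i - γ * (g t).y i| ^ q + |b i + γ * (g t).x i| ^ q = A i ^ q := fun i t ht => by
    rw [level_eq_of_isMax hpq hT htr hmax i ht, ha, hb,
      abs_mul_rpow_add (hA i) (abs_cosLp_rpow_add_abs_sinLp_rpow hpq.symm.pos _)]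
  rcases (hA i).eq_or_lt with h0 | h0
  · have := hlevel i t ht
    rw [← h0, Real.zero_rpow hpq.symm.ne_zero] at this
    obtain ⟨h1, h2⟩ := eq_zero_of_abs_rpow_add_eq_zero hpq.symm.ne_zero this
    rw [h1, h2, ← h0]
    simp
  -- From here A_i > 0, so conservation keeps the full covector away from zero and the control is
  -- determined almost everywhere, with the constant factor `L`.
  have hS := (sum_rpow_pos_or_eq_zero hpq.symm.ne_zero hA).resolve_right
    (fun h => h0.ne' (congrFun h i))
  set L := lqNorm q A ^ (-(q / p)) with hL
  have hcontrol : ∀ᵐ t, t ∈ Icc 0 T →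
      (w t).1 i = L * dualPow q (a i - γ * (g t).y i) ∧
      (w t).2 i = L * dualPow q (b i + γ * (g t).x i) := by
    filter_upwards [hmax] with t h1 hm
    have hsum : ∑ i, (|a i - γ * (g t).y i| ^ q + |b i + γ * (g t).x i| ^ q) = ∑ i, A i ^ q :=
      Finset.sum_congr rfl fun i _ => hlevel i t hm
    have h2 := eq_dual_of_isMax hpq (h := fun i => a i - γ * (g t).y i)
      (k := fun i => b i + γ * (g t).x i) (hsum ▸ hS) (htr.control_mem t hm) (h1 hm) i
    rw [hsum] at h2
    exact h2
  have hI := uIcc_of_le hT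
  have hH : AbsolutelyContinuousOnInterval (fun t => a i - γ * (g t).y i) 0 T :=
    (AbsolutelyContinuousOnInterval.const _).sub ((htr.ac_y i).const_mul _)
  have hK : AbsolutelyContinuousOnInterval (fun t => b i + γ * (g t).x i) 0 T :=
    (AbsolutelyContinuousOnInterval.const _).add ((htr.ac_x i).const_mul _)
  have cH := hI ▸ hH.continuousOn
  have cK := hI ▸ hK.continuousOn
  have dH : ∀ t ∈ Ico 0 T, HasDerivWithinAt (fun t => a i - γ * (g t).y i)
      (-γ * L * dualPow q (b i + γ * (g t).x i)) (Ici t) t := fun t =>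
    hH.hasDerivWithinAt_of_ae (g := fun t => -γ * L * dualPow q (b i + γ * (g t).x i)) hT
      (continuousOn_const.mul ((continuous_dualPow hq).comp_continuousOn cK)) (by
        filter_upwards [hcontrol, htr.deriv_y i] with t h1 h2 hm
        refine (((h2 hm).const_mul γ).const_sub (a i)).congr_deriv ?_
        simp only [Heisenberg.leftVelocity, (h1 hm).2]
        ring)
  have dK : ∀ t ∈ Ico 0 T, HasDerivWithinAt (fun t => b i + γ * (g t).x i)
      (γ * L * dualPow q (a i - γ * (g t).y i)) (Ici t) t := fun t =>
    hK.hasDerivWithinAt_of_ae (g := fun t => γ * L * dualPow q (a i - γ * (g t).y i)) hT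
      (continuousOn_const.mul ((continuous_dualPow hq).comp_continuousOn cH)) (by
        filter_upwards [hcontrol, htr.deriv_x i] with t h1 h2 hm
        refine (((h2 hm).const_mul γ).const_add (b i)).congr_deriv ?_
        simp only [Heisenberg.leftVelocity, (h1 hm).1]
        ring)
  -- Rescaling to the unit level costs A_i^(q-1) in the odd power and regains A_i^(-1) from the
  -- derivative, hence the angular speed γ A_i^(q-2) L.
  have hscale : ∀ x, dualPow q x = A i * A i ^ (q - 2) * dualPow q ((A i)⁻¹ * x) := fun x => by
    rw [mul_rpow_sub_two hq h0.le, ← dualPow_mul hq h0.le, mul_inv_cancel_left₀ h0.ne']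
  have hrot : IsRotation q (γ * A i ^ (q - 2) * L) 0 T
      (fun t => (A i)⁻¹ * (a i - γ * (g t).y i)) (fun t => (A i)⁻¹ * (b i + γ * (g t).x i)) :=
    { cont_fst := continuousOn_const.mul cH
      cont_snd := continuousOn_const.mul cK
      deriv_fst := fun t ht => ((dH t ht).const_mul _).congr_deriv (by
        rw [hscale (b i + γ * (g t).x i)]
        field_simp)
      deriv_snd := fun t ht => ((dK t ht).const_mul _).congr_deriv (by
        rw [hscale (a i - γ * (g t).y i)]
        field_simp)
      level := fun t ht => by
        have h1 := hlevel i t ht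
        rw [abs_mul, abs_mul, Real.mul_rpow (abs_nonneg _) (abs_nonneg _),
          Real.mul_rpow (abs_nonneg _) (abs_nonneg _), ← mul_add, h1, abs_of_pos (inv_pos.2 h0),
          Real.inv_rpow h0.le, inv_mul_cancel₀ (by positivity)] }
  obtain ⟨h1, h2⟩ := hrot.eqOn hq (isRotation_cosLp_sinLp hq _ (θ₀ i) 0 T)
    (by simp [htr.initial, ha, h0.ne']) (by simp [htr.initial, hb, h0.ne'])
  exact ⟨(inv_mul_eq_iff_eq_mul₀ h0.ne').1 (h1 ht), (inv_mul_eq_iff_eq_mul₀ h0.ne').1 (h2 ht)⟩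

theorem exists_curvedCurve_of_isMax (hpq : p.HolderConjugate q) (hT : 0 ≤ T) (hγ : γ ^ 2 = 1)
    (htr : Heisenberg.IsTrajectory (lpUnitBall n p) T g w)
    (hmax : ∀ᵐ t, t ∈ Icc 0 T → ∀ w' ∈ lpUnitBall n p,
      Heisenberg.reducedPontryagin a b γ (g t) w' ≤
        Heisenberg.reducedPontryagin a b γ (g t) (w t)) :
    ∃ A : Fin n → ℝ, (∀ i, 0 ≤ A i) ∧ ∃ θ₀, EqOn g (curvedCurve p q γ A θ₀) (Icc 0 T) := by
  choose A hA θ₀ ha hb using fun i => exists_polar hpq.symm.pos (a i) (b i)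
  have hcov := fun i {t} (ht : t ∈ Icc 0 T) =>
    covector_eq_of_isMax hpq hT htr hmax hA ha hb i ht
  refine ⟨A, hA, θ₀, ?_⟩
  -- For A = 0 the horizontal covector vanishes identically and maximality leaves the control free.
  -- Its vanishing with γ ≠ 0 still gives x = y = 0, and then z' = 0. Otherwise the control is the
  -- dual one, and equal controls give equal trajectories.
  by_cases hA0 : A = 0
  · subst hA0
    have hγ0 : γ ≠ 0 := fun h => by simp [h] at hγ
    have hx : ∀ i, ∀ t ∈ Icc 0 T, (g t).x i = 0 := fun i t ht => by
      simpa [hb, hγ0] using (hcov i ht).2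
    have hy : ∀ i, ∀ t ∈ Icc 0 T, (g t).y i = 0 := fun i t ht => by
      simpa [ha, hγ0] using (hcov i ht).1
    have hz : EqOn (fun t => (g t).z) (fun _ => 0) (Icc 0 T) := by
      refine htr.ac_z.eqOn_of_ae_hasDerivAt hT (.const _) (f' := fun _ => 0) ?_
        (.of_forall fun t _ => hasDerivAt_const t _) (by simp [htr.initial])
      filter_upwards [htr.deriv_z] with t h1 hm
      simpa [Heisenberg.leftVelocity, hx _ t hm, hy _ t hm] using h1 hm
    intro t ht
    ext i
    · simpa [curvedCurve] using hx i t ht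
    · simpa [curvedCurve] using hy i t ht
    · simpa [curvedCurve, lqNorm, Real.zero_rpow hpq.symm.ne_zero,
        Real.zero_rpow (inv_ne_zero hpq.symm.ne_zero)] using hz ht
  · have hcs := fun t i => abs_cosLp_rpow_add_abs_sinLp_rpow hpq.symm.pos
      (linearAngle p q γ A θ₀ i t)
    refine htr.eqOn hT (isTrajectory_curvedCurve hpq hT hγ hA fun _ _ => rfl) ?_
    filter_upwards [hmax] with t h1 hm
    refine eq_dualControl_of_isMax hpq hA hA0 (hcs t) (htr.control_mem t hm) fun w' hw' => ?_
    simpa only [Heisenberg.reducedPontryagin, fun i => (hcov i hm).1, fun i => (hcov i hm).2]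
      using h1 hm w' hw'

end Forward

end

theorem mainTheorem2 (n : ℕ) (p q : ℝ) (hp : 1 < p) (hpq : p * q = p + q)
    (T : ℝ) (hT : 0 ≤ T) (g : ℝ → Heisenberg n) :
    Heisenberg.IsExtremal (lpUnitBall n p) T g ↔
      ∃ (γ : ℝ) (A : Fin n → ℝ),
        (γ = 0 ∨ γ = 1 ∨ γ = -1) ∧ (∀ i, 0 ≤ A i) ∧ (γ ≠ 0 ∨ A ≠ 0) ∧
        (γ ≠ 0 → IsCurvedForm p q T γ A g) ∧
        (γ = 0 → IsStraightForm p q T A g) := by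
  have hc : p.HolderConjugate q := by
    rw [Real.holderConjugate_iff]
    have hq : q ≠ 0 := by rintro rfl; linarith
    refine ⟨hp, ?_⟩
    field_simp
    linarith
  constructor
  · intro h
    obtain ⟨w, a, b, γ, htr, hγ, h0, hmax⟩ := h.exists_normalized hT
    by_cases hγ0 : γ = 0
    · subst hγ0
      obtain ⟨A, hA, hA0, hcs⟩ := exists_straightCurve_of_isMax hc hT htr
        (h0.resolve_left fun h => h rfl) hmax
      exact ⟨0, A, hγ, hA, Or.inr hA0, fun h => absurd rfl h,
        fun _ => (isStraightForm_iff hc hA).2 hcs⟩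
    · have hγ2 : γ ^ 2 = 1 := sq_eq_one_iff.2 (hγ.resolve_left hγ0)
      obtain ⟨A, hA, hθ⟩ := exists_curvedCurve_of_isMax hc hT hγ2 htr hmax
      exact ⟨γ, A, hγ, hA, Or.inl hγ0, fun _ => (isCurvedForm_iff hA).2 hθ,
        fun h => absurd h hγ0⟩
  · rintro ⟨γ, A, hγ, hA, h0, hcurved, hstraight⟩
    by_cases hγ0 : γ = 0
    · obtain ⟨c, s, hcs, hg⟩ := (isStraightForm_iff hc hA).1 (hstraight hγ0)
      exact isExtremal_of_eqOn_straightCurve hc hT hA (h0.resolve_left fun h => h hγ0) hcs hg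
    · have hγ2 : γ ^ 2 = 1 := sq_eq_one_iff.2 (hγ.resolve_left hγ0)
      obtain ⟨θ₀, hg⟩ := (isCurvedForm_iff hA).1 (hcurved hγ0)
      exact isExtremal_of_eqOn_curvedCurve hc hT hγ2 hA hg
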